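/- **Setting.** Let $\ell$ be a number of servers, each holding the same database $\mathbf x=(x_1,\dots,x_n)\in(\{0,1\}^m)^n$. An $\ell$-server scheme consists of a randomized algorithm $\mathsf{Que}(1^\kappa,n,\alpha)$ that outputs queries $q_1,\dots,q_\ell$ and auxiliary information $\mathsf{aux}$, a deterministic algorithm $\mathsf{Ans}(\mathbf x,q_j)$ that outputs the answer $a_j$, and a deterministic algorithm $\mathsf{Rec}(a_1,\dots,a_\ell,\mathsf{aux})$ that outputs a block or the rejection symbol $\perp$; here $\kappa$ is the security parameter and $\alpha\in[n]$. Its communication complexity is the total number of bits of the $\ell$ queries and the $\ell$ answers. Consider the following properties. * *Correctness:* for all $\kappa,n,m,\mathbf x,\alpha$, if all servers answer honestly, then the client outputs $x_\alpha$ with probability $1$. * *Statistical $t$-privacy against selective-failure attacks:* for every $T\subseteq[\ell]$ with $|T|\le t$ there is a two-stage simulator $(\mathsf{Sim}_0,\mathsf{Sim}_1)$ of size polynomial in $\kappa$, $n$, $m$ and the bit length of the public parameters (two probabilistic Boolean circuits for each $\kappa,n,m,T$), such that, for every computationally unbounded probabilistic two-stage adversary $(\mathcal A_0,\mathcal A_1)$,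 every $\mathbf x$ and every $\alpha\in[n]$, the following two experiments have outputs at statistical distance at most a function of $\kappa$ alone that is negligible. *Real:* draw $((q_j)_j,\mathsf{aux})$ from $\mathsf{Que}(1^\kappa,n,\alpha)$; $\mathcal A_0(\mathbf x,(q_j)_{j\in T})$ outputs a state $\mathsf{st}$ and answers $(\tilde a_j)_{j\in T}$; the other servers answer honestly; let $b=1$ if $\mathsf{Rec}$ does not output $\perp$ and $b=0$ otherwise; output $\mathcal A_1(\mathsf{st},b)$. *Ideal:* $\mathsf{Sim}_0(1^\kappa,n,\mathbf x,T)$ outputs a simulator state and queries $(q'_j)_{j\in T}$; $\mathcal A_0(\mathbf x,(q'_j)_{j\in T})$ outputs $\mathsf{st}$ and $(\tilde a_j)_{j\in T}$; $\mathsf{Sim}_1$ outputs a bit $b$ from its state and $(\tilde a_j)_{j\in T}$; output $\mathcal A_1(\mathsf{st},b)$. * *$(v,\epsilon)$-integrity:* for all $\kappa,n,m,\mathbf x,\alpha$, every $V\subseteq[\ell]$ with $|V|\le v$ and every computationally unbounded probabilistic adversary that sees $\mathbf x$ and $(q_j)_{j\in V}$ and chooses the answers of the servers in $V$, the probability that the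 client outputs a value outside $\{x_\alpha,\perp\}$ is at most $\epsilon$. An $\ell$-server itAPIR (information-theoretic authenticated PIR) scheme that is statistically $t$-private is a scheme that is correct and satisfies statistical $t$-privacy against selective-failure attacks and an integrity property. **Theorem.** There is an absolute constant $C>0$ such that the following holds. Let $2\le\ell\le5$ and $1\le t<\ell$, and for each $\kappa$ let $p=p(\kappa)>2$ be the size of a finite field, such that $\frac{3}{p(\kappa)-2}$ is negligible in $\kappa$. Then there is an $\ell$-server itAPIR scheme that satisfies 1. correctness and statistical $t$-privacy against selective-failure attacks (with a simulator of size polynomial in $\kappa$, $n$, $m$ and $\log p$); 2. $(\ell-1,\epsilon)$-integrity with $\epsilon=\frac{3}{p-2}$; 3. for all $\kappa$, all $n\ge1$ and all block lengths $m$ with $2^m\le p$ (a block fits into one field element), its communication complexity is at most $$C\cdot\frac{\ell^2}{t}\left(\frac{n\ell}{t}\right)^{1/(\lfloor(2\ell-1)/t\rfloor-1)}\log p .$$ -/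

import Mathlib

/-- Bit strings of length `k`. -/
abbrev Bits (k : ℕ) : Type := Fin k → Bool

/-- Databases `x = (x_1, …, x_n)` of `n` blocks of `m` bits each. -/
abbrev Database (n m : ℕ) : Type := Fin n → Bits m

/-- Statistical distance of two distributions on the same set. -/
noncomputable def statDist {Ω : Type} (P Q : PMF Ω) : ℝ :=
  (1 / 2) * ∑' ω, |(P ω).toReal - (Q ω).toReal|

/-- Negligible functions of the security parameter: `κ ^ k * ν κ` tends to `0` for every `k`. -/
def Negligible (ν : ℕ → ℝ) : Prop :=
  Asymptotics.SuperpolynomialDecay Filter.atTop (fun κ : ℕ => (κ : ℝ)) ν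

/-! ### Boolean circuits -/

/-- A Boolean circuit (straight-line program) with input bits indexed by `ι` and output bits indexed
by `o`. A wire `Sum.inl i` is the `i`-th input bit, a wire `Sum.inr k` is the value of the `k`-th
gate. A gate is a binary Boolean operation together with the two wires that it reads. -/
structure Circuit (ι o : Type) where
  gates : List ((Bool → Bool → Bool) × (ι ⊕ ℕ) × (ι ⊕ ℕ))
  out : o → ι ⊕ ℕ

namespace Circuit

variable {ι o : Type}

/-- The value of a wire, given the input bits and the values of the gates evaluated so far
(a wire of a gate that is not yet evaluated reads `false`). -/
def wire (v : ι → Bool) (w : List Bool) : ι ⊕ ℕ → Bool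
  | Sum.inl i => v i
  | Sum.inr k => w.getD k false

/-- The values of the gates, evaluated one after the other. -/
def run (v : ι → Bool)
    (gs : List ((Bool → Bool → Bool) × (ι ⊕ ℕ) × (ι ⊕ ℕ))) : List Bool :=
  gs.foldl (fun w g => w ++ [g.1 (wire v w g.2.1) (wire v w g.2.2)]) []

/-- The function computed by a circuit. -/
def eval (C : Circuit ι o) (v : ι → Bool) : o → Bool :=
  fun i => wire v (run v C.gates) (C.out i)

/-- The number of gates plus the number of output bits. -/
def size [Fintype o] (C : Circuit ι o) : ℕ :=
  C.gates.length + Fintype.card o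

end Circuit

/-! ### Authenticated private information retrieval -/

/-- The algorithms of an `ℓ`-server itAPIR scheme. The parameters `κ` (security parameter), `n`
(number of blocks) and `m` (block length) are public. Queries and answers are bit strings; their
lengths depend on the public parameters only, and queries do not depend on `m`. -/
structure Scheme (ℓ : ℕ) where
  /-- length of a query to one server -/
  qlen : ℕ → ℕ → ℕ
  /-- length of the answer of one server -/
  alen : ℕ → ℕ → ℕ → ℕ
  /-- auxiliary information kept by the client -/
  Aux : ℕ → ℕ → Type
  /-- the randomized querying algorithm -/
  Que : (κ n : ℕ) → Fin n → PMF ((Fin ℓ → Bits (qlen κ n)) × Aux κ n)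
  /-- the deterministic answering algorithm -/
  Ans : (κ n m : ℕ) → Database n m → Bits (qlen κ n) → Bits (alen κ n m)
  /-- the deterministic reconstructing algorithm; `none` stands for rejection -/
  Rec : (κ n m : ℕ) → (Fin ℓ → Bits (alen κ n m)) → Aux κ n → Option (Bits m)

/-- A two-stage probabilistic, computationally unbounded adversary that controls the servers indexed
by `τ`. The first stage sees the database and the queries to these servers and chooses a state and
the answers of these servers, the second stage sees the state and the acceptance bit. -/
structure Adversary (n m qlen alen : ℕ) (τ : Type) where
  St : Type
  Out : Type
  first : Database n m → (τ → Bits qlen) → PMF (St × (τ → Bits alen))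
  second : St → Bool → PMF Out

/-- A two-stage simulator, given by two probabilistic Boolean circuits: each stage reads its input
and a string of uniformly random bits. The first stage reads the database and outputs a state and
queries to the corrupted servers, the second stage reads the state and the answers of the corrupted
servers and outputs a bit. -/
structure Simulator (n m qlen alen : ℕ) (τ : Type) where
  coins₀ : ℕ
  coins₁ : ℕ
  stlen : ℕ
  stage₀ : Circuit ((Fin n × Fin m) ⊕ Fin coins₀) (Fin stlen ⊕ (τ × Fin qlen))
  stage₁ : Circuit ((Fin stlen ⊕ (τ × Fin alen)) ⊕ Fin coins₁) Unit

namespace Simulator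

variable {n m qlen alen : ℕ} {τ : Type}

/-- The total size of the two circuits. -/
def size [Fintype τ] (S : Simulator n m qlen alen τ) : ℕ :=
  S.stage₀.size + S.stage₁.size

/-- The joint distribution of the state and of the queries that the first stage outputs. -/
noncomputable def sim₀ (S : Simulator n m qlen alen τ) (x : Database n m) :
    PMF (Bits S.stlen × (τ → Bits qlen)) :=
  (PMF.uniformOfFintype (Bits S.coins₀)).map fun r =>
    let z := S.stage₀.eval (Sum.elim (fun ij => x ij.1 ij.2) r)
    (fun i => z (Sum.inl i), fun j i => z (Sum.inr (j, i)))

/-- The distribution of the bit that the second stage outputs. -/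
noncomputable def sim₁ (S : Simulator n m qlen alen τ) (st : Bits S.stlen) (a : τ → Bits alen) :
    PMF Bool :=
  (PMF.uniformOfFintype (Bits S.coins₁)).map fun r =>
    S.stage₁.eval (Sum.elim (Sum.elim st fun ji => a ji.1 ji.2) r) ()

end Simulator

namespace Scheme

variable {ℓ : ℕ} (Γ : Scheme ℓ)

/-- The answers the client receives: servers in `T` answer `a`, all others answer honestly. -/
def answers {κ n m : ℕ} (x : Database n m) (T : Finset (Fin ℓ)) (q : Fin ℓ → Bits (Γ.qlen κ n))
    (a : T → Bits (Γ.alen κ n m)) : Fin ℓ → Bits (Γ.alen κ n m) :=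
  fun j => if h : j ∈ T then a ⟨j, h⟩ else Γ.Ans κ n m x (q j)

/-- Correctness: if all servers are honest, the client outputs `x_α` with probability `1`. -/
def Correct : Prop :=
  ∀ (κ n m : ℕ) (x : Database n m) (α : Fin n),
    ((Γ.Que κ n α).map fun z => Γ.Rec κ n m (fun j => Γ.Ans κ n m x (z.1 j)) z.2) (some (x α)) = 1

/-- The output of the client when the servers in `V` answer according to the probabilistic
strategy `A`. -/
noncomputable def clientOutput (κ n m : ℕ) (x : Database n m) (α : Fin n) (V : Finset (Fin ℓ))
    (A : Database n m → (V → Bits (Γ.qlen κ n)) → PMF (V → Bits (Γ.alen κ n m))) :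
    PMF (Option (Bits m)) := do
  let (q, aux) ← Γ.Que κ n α
  let a ← A x (fun j => q j)
  return Γ.Rec κ n m (Γ.answers x V q a) aux

/-- `(v, ε)`-integrity: no coalition of at most `v` servers makes the client output a value
outside `{x_α, ⊥}` with probability larger than `ε`. -/
def Integrity (v : ℕ) (ε : ℕ → ℝ) : Prop :=
  ∀ (κ n m : ℕ) (x : Database n m) (α : Fin n) (V : Finset (Fin ℓ)), V.card ≤ v →
    ∀ A : Database n m → (V → Bits (Γ.qlen κ n)) → PMF (V → Bits (Γ.alen κ n m)),
      (Γ.clientOutput κ n m x α V A).toOuterMeasure {y | y ≠ some (x α) ∧ y ≠ none}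
        ≤ ENNReal.ofReal (ε κ)

/-- The real experiment: the output of the adversary that controls the servers in `T`, sees their
queries, chooses their answers, and learns whether the client accepts. -/
noncomputable def real (κ n m : ℕ) (x : Database n m) (α : Fin n) (T : Finset (Fin ℓ))
    (A : Adversary n m (Γ.qlen κ n) (Γ.alen κ n m) T) : PMF A.Out := do
  let (q, aux) ← Γ.Que κ n α
  let (st, a) ← A.first x (fun j => q j)
  A.second st (Γ.Rec κ n m (Γ.answers x T q a) aux).isSome

/-- The ideal experiment: the simulator, which does not know the retrieval index, provides the
queries and the acceptance bit. -/
noncomputable def ideal {κ n m : ℕ} {T : Finset (Fin ℓ)}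
    (S : Simulator n m (Γ.qlen κ n) (Γ.alen κ n m) T) (x : Database n m)
    (A : Adversary n m (Γ.qlen κ n) (Γ.alen κ n m) T) : PMF A.Out := do
  let (stS, q) ← S.sim₀ x
  let (st, a) ← A.first x q
  let b ← S.sim₁ stS a
  A.second st b

/-- Statistical `t`-privacy against selective-failure attacks. One simulator serves all adversaries;
its two stages have size polynomial in `κ`, `n`, `m` and the bit length `L κ` of further public
parameters. The statistical distance of the real and the ideal experiment is negligible in `κ`,
uniformly in all other data. -/
def StatPrivate (t : ℕ) (L : ℕ → ℕ) : Prop :=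
  ∃ (S : (κ n m : ℕ) → (T : Finset (Fin ℓ)) → Simulator n m (Γ.qlen κ n) (Γ.alen κ n m) T)
    (c : ℕ) (ν : ℕ → ℝ), Negligible ν ∧
    ∀ (κ n m : ℕ) (T : Finset (Fin ℓ)), 1 ≤ n → T.card ≤ t →
      (S κ n m T).size ≤ (κ + n + m + L κ + 2) ^ c ∧
      ∀ (x : Database n m) (α : Fin n) (A : Adversary n m (Γ.qlen κ n) (Γ.alen κ n m) T),
        statDist (Γ.real κ n m x α T A) (Γ.ideal (S κ n m T) x A) ≤ ν κ

/-- Communication complexity: the total number of bits of the `ℓ` queries and `ℓ` answers. -/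
def comm (κ n m : ℕ) : ℕ :=
  ℓ * (Γ.qlen κ n + Γ.alen κ n m)

end Scheme

/-! Retrieval is by polynomials along curves. With `d = ⌊(2ℓ-1)/t⌋ - 1`, indices are words of length
`d` over an alphabet of about `n^(1/d)` letters, and the database becomes a polynomial of degree `d`
whose value at `indexPoint α` is `x_α`. The client draws a random curve of degree `t` through that
point and gives each server one point of it. Value and gradient at this point determine the value
and the derivative of the restriction to the curve. The restriction has degree at most `t * d < 2 *
ℓ`, so Hermite interpolation at the `ℓ` nodes recovers its value at `0` (`hermite_evalMap`).

For authentication, server `i` does not get its point alone. It gets a random curve of degree `t`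
starting there, and it answers with the whole restriction of value and gradient to this curve. Every
server `h` also evaluates at one point of the curve of `i`, with a secret parameter reserved for the
pair, and the client checks consistency. If `h` is honest, an accepted false restriction means that
the secret parameter is a root of a nonzero polynomial of degree at most `t * d`. The coalition's
queries do not depend on this parameter, so it may be redrawn after the answers are fixed. Hence
accepted tampering has probability at most `ℓ * t * d / 2^(σ+1)` (`attack_undetected_le`).

This bound gives integrity at once. It also handles selective failure: up to that error, the client
accepts exactly when the corrupted answers are the honest ones, and a simulator can decide this from
the database and the queries. The queries are simulated perfectly: at most `t` points on a random
curve of degree `t` with fixed start are uniform and independent (`map_query_eq_map_simQuery`).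

All arithmetic is over a field of characteristic two with more than `p` elements. Every bit of a
simulated query or an honest answer is then an `𝔽₂`-polynomial of bounded degree in the input bits,
so listing monomials gives circuits of polynomial size (`LowDeg.cost`). As `ℓ ≤ 5`, all factors
depending on `ℓ`, `t`, `d` disappear into the constant. -/

/-! ### Circuits for polynomials of bounded degree over `𝔽₂` -/

namespace Circuit

variable {ι o : Type}

/-- The wire `w` of the gate list `gs` carries the Boolean function `f`. -/
def Realizes (gs : List ((Bool → Bool → Bool) × (ι ⊕ ℕ) × (ι ⊕ ℕ))) (w : ι ⊕ ℕ)
    (f : (ι → Bool) → Bool) : Prop :=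
  (∀ k, w = Sum.inr k → k < gs.length) ∧ ∀ v, wire v (run v gs) w = f v

theorem run_concat (v : ι → Bool) (gs : List ((Bool → Bool → Bool) × (ι ⊕ ℕ) × (ι ⊕ ℕ)))
    (g : (Bool → Bool → Bool) × (ι ⊕ ℕ) × (ι ⊕ ℕ)) :
    run v (gs ++ [g]) =
      run v gs ++ [g.1 (wire v (run v gs) g.2.1) (wire v (run v gs) g.2.2)] := by
  simp [run, List.foldl_append]

theorem length_run (v : ι → Bool) (gs : List ((Bool → Bool → Bool) × (ι ⊕ ℕ) × (ι ⊕ ℕ))) :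
    (run v gs).length = gs.length := by
  induction gs using List.reverseRecOn with
  | nil => rfl
  | append_singleton gs g ih => rw [run_concat]; simp [ih]

/-- Gates read only inputs and earlier gates, so later gates never change a wire that is already in
range. -/
theorem Realizes.append {gs : List ((Bool → Bool → Bool) × (ι ⊕ ℕ) × (ι ⊕ ℕ))} {w : ι ⊕ ℕ}
    {f : (ι → Bool) → Bool} (h : Realizes gs w f)
    (hs : List ((Bool → Bool → Bool) × (ι ⊕ ℕ) × (ι ⊕ ℕ))) : Realizes (gs ++ hs) w f := by
  induction hs using List.reverseRecOn with
  | nil => simpa using h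
  | append_singleton hs g ih =>
    rw [← List.append_assoc]
    refine ⟨fun k hk => ?_, fun v => ?_⟩
    · have := ih.1 k hk
      simp only [List.length_append, List.length_singleton] at this ⊢
      omega
    · rw [run_concat, ← ih.2 v]
      cases w with
      | inl i => rfl
      | inr k =>
        have := ih.1 k rfl
        rw [← length_run v] at this
        simp only [wire, List.getD_eq_getElem?_getD, List.getElem?_append_left this]

/-- Any circuit can be extended by at most `B` gates to one that has a wire carrying `f`. -/
def Cost (f : (ι → Bool) → Bool) (B : ℕ) : Prop :=
  ∀ gs : List ((Bool → Bool → Bool) × (ι ⊕ ℕ) × (ι ⊕ ℕ)),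
    ∃ hs : List ((Bool → Bool → Bool) × (ι ⊕ ℕ) × (ι ⊕ ℕ)),
      hs.length ≤ B ∧ ∃ w, Realizes (gs ++ hs) w f

theorem Cost.input (i : ι) : Cost (fun v => v i) 0 := fun gs =>
  ⟨[], by simp, Sum.inl i, by simp, fun v => rfl⟩

theorem Cost.mono {f : (ι → Bool) → Bool} {B B' : ℕ} (h : Cost f B) (hB : B ≤ B') : Cost f B' :=
  fun gs => let ⟨hs, h1, h2⟩ := h gs; ⟨hs, h1.trans hB, h2⟩

/-- Since `Cost` allows an arbitrary initial gate list, the circuit for `g` can be built on top of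
the one for `f`. -/
theorem Cost.op {f g : (ι → Bool) → Bool} {a b : ℕ} (hf : Cost f a) (hg : Cost g b)
    (φ : Bool → Bool → Bool) : Cost (fun v => φ (f v) (g v)) (a + b + 1) := by
  intro gs
  obtain ⟨hs, h1, w, hw⟩ := hf gs
  obtain ⟨ks, h2, u, hu⟩ := hg (gs ++ hs)
  refine ⟨hs ++ ks ++ [(φ, w, u)], by simp; omega, Sum.inr (gs ++ hs ++ ks).length, ?_, fun v => ?_⟩
  · rintro k ⟨⟩
    simp only [List.length_append, List.length_singleton]
    omega
  · have hw' := (hw.append ks).2 v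
    have hu' := hu.2 v
    have e : gs ++ (hs ++ ks ++ [(φ, w, u)]) = gs ++ hs ++ ks ++ [(φ, w, u)] := by simp
    rw [e, run_concat]
    simp only [hw', hu']
    simp only [wire, ← length_run v, List.getD_eq_getElem?_getD]
    simp

theorem Cost.const (c : Bool) : Cost (fun _ : ι → Bool => c) 1 := by
  intro gs
  -- The gate ignores its inputs, so the wires it names are irrelevant.
  refine ⟨[(fun _ _ => c, Sum.inr 0, Sum.inr 0)], by simp, Sum.inr gs.length, ?_, fun v => ?_⟩
  · rintro k ⟨⟩
    simp
  · rw [run_concat]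
    simp only [wire, ← length_run v, List.getD_eq_getElem?_getD]
    simp

theorem Cost.forall_mem {J : Type} (s : Finset J) {f : J → (ι → Bool) → Bool} {B : ℕ}
    (h : ∀ j ∈ s, Cost (f j) B) :
    Cost (fun v => decide (∀ j ∈ s, f j v = true)) (s.card * (B + 1) + 1) := by
  classical
  induction s using Finset.induction_on with
  | empty => simpa using Cost.const true
  | insert a s ha ih =>
    have := (h a (by simp)).op (ih fun j hj => h j (by simp [hj])) (fun x y => x && y)
    rw [Finset.card_insert_of_notMem ha]
    have e : (fun v => decide (∀ j ∈ insert a s, f j v = true)) =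
        fun v => (fun x y => x && y) (f a v) (decide (∀ j ∈ s, f j v = true)) := by
      funext v
      simp
    rw [e]
    exact this.mono (by ring_nf; omega)

theorem Cost.parity {J : Type} (s : Finset J) {f : J → (ι → Bool) → Bool} {B : ℕ}
    (h : ∀ j ∈ s, Cost (f j) B) :
    Cost (fun v => decide (∑ j ∈ s, (if f j v = true then 1 else 0 : ZMod 2) = 1))
      (s.card * (B + 1) + 1) := by
  classical
  induction s using Finset.induction_on with
  | empty => simpa using Cost.const false
  | insert a s ha ih =>
    have := (h a (by simp)).op (ih fun j hj => h j (by simp [hj])) Bool.xor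
    rw [Finset.card_insert_of_notMem ha]
    have e : (fun v => decide (∑ j ∈ insert a s, (if f j v = true then 1 else 0 : ZMod 2) = 1)) =
        fun v => Bool.xor (f a v)
          (decide (∑ j ∈ s, (if f j v = true then 1 else 0 : ZMod 2) = 1)) := by
      funext v
      rw [Finset.sum_insert ha]
      generalize (∑ j ∈ s, (if f j v = true then 1 else 0 : ZMod 2)) = z
      cases f a v <;> revert z <;> decide
    rw [e]
    exact this.mono (by ring_nf; omega)

/-- Finitely many functions of cost at most `B` are computed by one circuit. -/
theorem exists_eval_eq [Fintype o] {f : o → (ι → Bool) → Bool} {B : ℕ} (h : ∀ i, Cost (f i) B) :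
    ∃ C : Circuit ι o, (∀ v i, C.eval v i = f i v) ∧ C.size ≤ Fintype.card o * (B + 1) := by
  classical
  have key : ∀ s : Finset o, ∃ gs : List ((Bool → Bool → Bool) × (ι ⊕ ℕ) × (ι ⊕ ℕ)),
      gs.length ≤ s.card * B ∧ ∀ i ∈ s, ∃ w, Realizes gs w (f i) := by
    intro s
    induction s using Finset.induction_on with
    | empty => exact ⟨[], by simp, by simp⟩
    | insert a s ha ih =>
      obtain ⟨gs, h1, h2⟩ := ih
      obtain ⟨hs, h3, w, hw⟩ := h a gs
      refine ⟨gs ++ hs, ?_, fun i hi => ?_⟩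
      · rw [Finset.card_insert_of_notMem ha, List.length_append]
        ring_nf
        ring_nf at h1
        omega
      · rcases Finset.mem_insert.1 hi with rfl | hi
        · exact ⟨w, hw⟩
        · obtain ⟨u, hu⟩ := h2 i hi
          exact ⟨u, hu.append hs⟩
  obtain ⟨gs, h1, h2⟩ := key Finset.univ
  choose w hw using fun i => h2 i (Finset.mem_univ i)
  refine ⟨⟨gs, w⟩, fun v i => (hw i).2 v, ?_⟩
  rw [Finset.card_univ] at h1
  simp only [size]
  ring_nf
  ring_nf at h1
  omega

end Circuit

/-! ### Low-degree functions of bits and the cost of evaluating them -/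

/-- Functions of bits with values in an abelian group that are polynomials of degree at most `D`. -/
def LowDeg {ι A : Type*} [AddCommMonoid A] (D : ℕ) (f : (ι → Bool) → A) : Prop :=
  f ∈ AddSubmonoid.closure
    {g : (ι → Bool) → A | ∃ (S : Finset ι) (a : A), S.card ≤ D ∧
      g = fun v => if ∀ i ∈ S, v i = true then a else 0}

namespace LowDeg

section AddCommMonoid

variable {ι A A' : Type*} [AddCommMonoid A] [AddCommMonoid A'] {D D' : ℕ} {f g : (ι → Bool) → A}

theorem mono (h : LowDeg D f) (hD : D ≤ D') : LowDeg D' f := by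
  refine AddSubmonoid.closure_mono ?_ h
  rintro g ⟨S, a, hS, rfl⟩
  exact ⟨S, a, hS.trans hD, rfl⟩

theorem const (a : A) : LowDeg D (fun _ : ι → Bool => a) :=
  AddSubmonoid.subset_closure ⟨∅, a, by simp, by simp⟩

theorem add (hf : LowDeg D f) (hg : LowDeg D g) : LowDeg D (fun v => f v + g v) :=
  AddSubmonoid.add_mem _ hf hg

theorem sum {J : Type*} (s : Finset J) {f : J → (ι → Bool) → A} (h : ∀ j ∈ s, LowDeg D (f j)) :
    LowDeg D (fun v => ∑ j ∈ s, f j v) := by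
  have e : (fun v => ∑ j ∈ s, f j v) = ∑ j ∈ s, f j := by
    funext v
    simp
  rw [e]
  exact AddSubmonoid.sum_mem _ h

/-- Additive maps act on coefficients only. Hence passing between field elements, their bits and
polynomial coefficients costs no degree. -/
theorem comp_addMonoidHom (h : LowDeg D f) (φ : A →+ A') : LowDeg D (fun v => φ (f v)) := by
  unfold LowDeg at h
  induction h using AddSubmonoid.closure_induction with
  | mem g hg =>
    obtain ⟨S, a, hS, rfl⟩ := hg
    refine AddSubmonoid.subset_closure ⟨S, φ a, hS, ?_⟩
    funext v
    by_cases hv : ∀ i ∈ S, v i = true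
    · simp only [if_pos hv]
    · simp only [if_neg hv, map_zero]
  | zero => simpa using const (D := D) (ι := ι) (0 : A')
  | add f g _ _ hf hg => simpa using hf.add hg

theorem input (i : ι) (a : A) (hD : 1 ≤ D) : LowDeg D (fun v => if v i = true then a else 0) :=
  AddSubmonoid.subset_closure ⟨{i}, a, by simpa, by simp⟩

/-- Collecting coefficients by monomial bounds the number of terms, which membership in the closure
alone does not. -/
theorem exists_eq_sum [Fintype ι] (h : LowDeg D f) :
    ∃ c : Finset ι → A, f = fun v =>
      ∑ S with S.card ≤ D, if ∀ i ∈ S, v i = true then c S else 0 := by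
  classical
  unfold LowDeg at h
  induction h using AddSubmonoid.closure_induction with
  | mem g hg =>
    obtain ⟨S, a, hS, rfl⟩ := hg
    refine ⟨fun R => if R = S then a else 0, ?_⟩
    funext v
    rw [Finset.sum_eq_single S]
    · simp
    · intro R _ hR
      simp [hR]
    · simp [hS]
  | zero => exact ⟨0, by funext; simp⟩
  | add f g _ _ hf hg =>
    obtain ⟨c, rfl⟩ := hf
    obtain ⟨c', rfl⟩ := hg
    refine ⟨c + c', ?_⟩
    funext v
    simp only [Pi.add_apply, ← Finset.sum_add_distrib]
    refine Finset.sum_congr rfl fun S _ => ?_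
    split_ifs <;> simp

end AddCommMonoid

section CommSemiring

variable {ι A : Type*} [CommSemiring A] {D D' : ℕ} {f g : (ι → Bool) → A}

/-- Bits are idempotent: the product of the monomials of `S` and `R` is that of `S ∪ R`. -/
theorem mul (hf : LowDeg D f) (hg : LowDeg D' g) : LowDeg (D + D') (fun v => f v * g v) := by
  classical
  unfold LowDeg at hf hg
  induction hf using AddSubmonoid.closure_induction with
  | mem f hf =>
    obtain ⟨S, a, hS, rfl⟩ := hf
    induction hg using AddSubmonoid.closure_induction with
    | mem g hg =>
      obtain ⟨R, b, hR, rfl⟩ := hg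
      refine AddSubmonoid.subset_closure
        ⟨S ∪ R, a * b, (Finset.card_union_le _ _).trans (by omega), ?_⟩
      funext v
      beta_reduce
      by_cases h : ∀ i ∈ S ∪ R, v i = true
      · rw [if_pos h, if_pos fun i hi => h i (Finset.mem_union_left _ hi),
          if_pos fun i hi => h i (Finset.mem_union_right _ hi)]
      · rw [if_neg h]
        by_cases h1 : ∀ i ∈ S, v i = true
        · rw [if_neg fun h2 => h (Finset.forall_mem_union.2 ⟨h1, h2⟩), mul_zero]
        · rw [if_neg h1, zero_mul]
    | zero => simpa using const (ι := ι) (D := D + D') (0 : A)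
    | add f g _ _ hf hg => simpa [mul_add] using hf.add hg
  | zero => simpa using const (ι := ι) (D := D + D') (0 : A)
  | add f g _ _ hf hg => simpa [add_mul] using hf.add hg

theorem prod {J : Type*} (s : Finset J) {f : J → (ι → Bool) → A} (h : ∀ j ∈ s, LowDeg D (f j)) :
    LowDeg (s.card * D) (fun v => ∏ j ∈ s, f j v) := by
  classical
  induction s using Finset.induction_on with
  | empty => simpa using const (ι := ι) (1 : A)
  | insert a s ha ih =>
    have := (h a (by simp)).mul (ih fun j hj => h j (by simp [hj]))
    simp only [Finset.prod_insert ha, Finset.card_insert_of_notMem ha]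
    exact this.mono (by ring_nf; omega)

theorem pow (h : LowDeg D f) (e : ℕ) : LowDeg (e * D) (fun v => f v ^ e) := by
  simpa using prod (Finset.range e) (f := fun _ => f) fun _ _ => h

end CommSemiring

end LowDeg

/-- Every set of at most `D` elements is the set of proper values of some map `Fin D → Option ι`;
`none` fills unused places. -/
theorem card_filter_card_le (ι : Type*) [Fintype ι] (D : ℕ) :
    (Finset.univ.filter fun S : Finset ι => S.card ≤ D).card ≤ (Fintype.card ι + 1) ^ D := by
  classical
  have hc : (Finset.univ : Finset (Fin D → Option ι)).card = (Fintype.card ι + 1) ^ D := by simp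
  rw [← hc]
  refine Finset.card_le_card_of_surjOn (fun g => Finset.univ.filter fun i => ∃ j, g j = some i) ?_
  intro S hS
  have hS : S.card ≤ D := by simpa using hS
  refine ⟨fun j => if h : (j : ℕ) < S.card then some (S.equivFin.symm ⟨j, h⟩ : ι) else none,
    by simp, ?_⟩
  ext i
  simp only [Finset.mem_filter, Finset.mem_univ, true_and]
  constructor
  · rintro ⟨j, hj⟩
    split_ifs at hj with h
    have := Option.some.inj hj
    exact this ▸ (S.equivFin.symm ⟨j, h⟩).2
  · intro hi
    have := (S.equivFin ⟨i, hi⟩).2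
    refine ⟨⟨S.equivFin ⟨i, hi⟩, this.trans_le hS⟩, ?_⟩
    simp

/-- The identification of bits with the elements of `𝔽₂`. -/
def bitEquiv : Bool ≃ ZMod 2 where
  toFun b := if b = true then 1 else 0
  invFun z := decide (z = 1)
  left_inv := by decide
  right_inv := by decide

/-- An `𝔽₂`-polynomial is a parity of conjunctions, one for each monomial with coefficient `1`. -/
theorem LowDeg.cost {ι : Type} [Fintype ι] {D : ℕ} {f : (ι → Bool) → Bool}
    (h : LowDeg D fun v => bitEquiv (f v)) :
    Circuit.Cost f ((Fintype.card ι + 1) ^ D * (D + 3) + 1) := by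
  classical
  obtain ⟨c, hc⟩ := h.exists_eq_sum
  have e : f = fun v => decide (∑ S with S.card ≤ D ∧ c S = 1,
      (if decide (∀ i ∈ S, v i = true) = true then 1 else 0 : ZMod 2) = 1) := by
    funext v
    have := congrFun hc v
    rw [← bitEquiv.symm_apply_apply (f v), this]
    simp only [bitEquiv, Equiv.coe_fn_symm_mk]
    rw [← Finset.filter_filter, Finset.sum_filter (fun S => c S = 1)]
    congr 2
    refine Finset.sum_congr rfl fun S _ => ?_
    have h2 : ∀ z : ZMod 2, z ≠ 1 → z = 0 := by decide
    by_cases hz : c S = 1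
    · simp only [hz, if_true, decide_eq_true_eq]
    · rw [if_neg hz, h2 _ hz, ite_self]
  rw [e]
  refine (Circuit.Cost.parity (B := D + 1 + 1) _ fun S hS => ?_).mono ?_
  · have hS : S.card ≤ D := (Finset.mem_filter.1 hS).2.1
    have h0 := Circuit.Cost.forall_mem (B := 0) S (f := fun i v => v i) fun i _ =>
      Circuit.Cost.input i
    convert h0.mono (B' := D + 1 + 1) (by omega)
  · refine Nat.add_le_add_right (Nat.mul_le_mul ?_ (by omega)) 1
    refine le_trans (Finset.card_le_card ?_) (card_filter_card_le ι D)
    intro S hS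
    simp only [Finset.mem_filter, Finset.mem_univ, true_and] at hS ⊢
    exact hS.1

/-! ### Uniform distributions and statistical distance -/

namespace PMF

/-- The nonempty fibres of an affine map are translates of one another, so the image distribution is
uniform on the range. -/
theorem map_uniformOfFintype_apply {A Z : Type*} [AddCommGroup A] [Fintype A] [AddCommGroup Z]
    [DecidableEq Z] (f : A → Z) (hf : ∀ a a', f (a + a') = f a + f a' - f 0) (z : Z) :
    (uniformOfFintype A).map f z =
      if z ∈ Finset.univ.image f then ((Finset.univ.image f).card : ENNReal)⁻¹ else 0 := by
  have hsum : (uniformOfFintype A).map f z =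
      ((Finset.univ.filter fun a => f a = z).card : ENNReal) * (Fintype.card A : ENNReal)⁻¹ := by
    rw [map_apply, tsum_fintype]
    simp only [uniformOfFintype_apply, eq_comm (a := z)]
    rw [← Finset.sum_filter, Finset.sum_const, nsmul_eq_mul]
  have hfib : ∀ a₀, (Finset.univ.filter fun a => f a = f a₀).card =
      (Finset.univ.filter fun a => f a = f 0).card := by
    intro a₀
    refine Finset.card_bij' (fun a _ => a - a₀) (fun a _ => a + a₀) ?_ ?_ ?_ ?_
    · intro a ha
      have ha : f a = f a₀ := by simpa using ha
      have := hf (a - a₀) a₀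
      rw [sub_add_cancel, ha] at this
      simp only [Finset.mem_filter, Finset.mem_univ, true_and]
      rw [eq_sub_iff_add_eq, add_comm, add_left_inj] at this
      exact this.symm
    · intro a ha
      have ha : f a = f 0 := by simpa using ha
      simp [hf, ha]
    · simp
    · simp
  have hcard := Finset.card_eq_sum_card_image f (Finset.univ : Finset A)
  rw [Finset.sum_congr rfl (g := fun _ => (Finset.univ.filter fun a => f a = f 0).card)
    (by
      intro z hz
      obtain ⟨a, -, rfl⟩ := Finset.mem_image.1 hz
      exact hfib a), Finset.sum_const, smul_eq_mul, Finset.card_univ] at hcard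
  have hk : (Finset.univ.filter fun a => f a = f 0).card ≠ 0 :=
    Finset.card_ne_zero.2 ⟨0, by simp⟩
  rw [hsum]
  split_ifs with h
  · obtain ⟨a, -, rfl⟩ := Finset.mem_image.1 h
    have hI : (Finset.univ.image f).card ≠ 0 := Finset.card_ne_zero.2 ⟨_, h⟩
    rw [hfib, hcard, Nat.cast_mul,
      ENNReal.mul_inv (Or.inl (by exact_mod_cast hI)) (Or.inl (ENNReal.natCast_ne_top _)),
      mul_left_comm, ENNReal.mul_inv_cancel (by exact_mod_cast hk) (ENNReal.natCast_ne_top _),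
      mul_one]
  · have : (Finset.univ.filter fun a => f a = z) = ∅ := by
      ext a
      simp only [Finset.mem_filter, Finset.mem_univ, true_and, Finset.notMem_empty, iff_false]
      rintro rfl
      exact h (Finset.mem_image_of_mem _ (Finset.mem_univ _))
    simp [this]

/-- Affine maps with the same range push the uniform distribution forward to the same
distribution. -/
theorem map_uniformOfFintype_eq {A B Z : Type*} [AddCommGroup A] [Fintype A] [AddCommGroup B]
    [Fintype B] [AddCommGroup Z] {f : A → Z} {g : B → Z}
    (hf : ∀ a a', f (a + a') = f a + f a' - f 0) (hg : ∀ b b', g (b + b') = g b + g b' - g 0)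
    (h : Set.range f = Set.range g) :
    (uniformOfFintype A).map f = (uniformOfFintype B).map g := by
  classical
  have e : Finset.univ.image f = Finset.univ.image g := by
    apply Finset.coe_injective
    simpa using h
  ext z
  rw [map_uniformOfFintype_apply f hf, map_uniformOfFintype_apply g hg, e]

theorem map_uniformOfFintype_equiv {A B : Type*} [Fintype A] [Nonempty A] [Fintype B] [Nonempty B]
    (e : A ≃ B) : (uniformOfFintype A).map e = uniformOfFintype B := by
  classical
  ext b
  rw [map_apply, tsum_eq_single (e.symm b)]
  · simp [Fintype.card_congr e]
  · intro a ha
    rw [if_neg]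
    rintro rfl
    simp at ha

theorem uniformOfFintype_prod {A B : Type*} [Fintype A] [Nonempty A] [Fintype B] [Nonempty B] :
    uniformOfFintype (A × B) =
      (uniformOfFintype A).bind fun a => (uniformOfFintype B).map fun b => (a, b) := by
  classical
  ext ⟨a, b⟩
  rw [bind_apply, tsum_eq_single a, map_apply, tsum_eq_single b]
  · simp [ENNReal.mul_inv]
  · intro b' hb
    simp [hb.symm]
  · intro a' ha
    rw [map_apply]
    simp [ha.symm]

/-- Resampling one coordinate of a uniform tuple does not change its distribution. -/
theorem bind_update_uniformOfFintype {ι X : Type*} [Fintype ι] [DecidableEq ι] [AddCommGroup X]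
    [Fintype X] (i : ι) :
    ((uniformOfFintype (ι → X)).bind fun r => (uniformOfFintype X).map (Function.update r i)) =
      uniformOfFintype (ι → X) := by
  have h1 : ((uniformOfFintype (ι → X)).bind fun r =>
      (uniformOfFintype X).map (Function.update r i)) =
      (uniformOfFintype ((ι → X) × X)).map fun z => Function.update z.1 i z.2 := by
    rw [uniformOfFintype_prod, map_bind]
    simp only [map_comp]
    rfl
  rw [h1]
  conv_rhs => rw [← map_id (uniformOfFintype (ι → X))]
  refine map_uniformOfFintype_eq ?_ (by simp) ?_
  · intro a a'
    funext j
    by_cases h : j = i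
    · subst h; simp
    · simp [h]
  · rw [Set.range_id]
    exact Set.range_eq_univ.2 fun r => ⟨(r, r i), by simp⟩

theorem toOuterMeasure_le_one {A : Type*} (P : PMF A) (s : Set A) : P.toOuterMeasure s ≤ 1 := by
  rw [toOuterMeasure_apply, ← P.tsum_coe]
  exact ENNReal.tsum_le_tsum fun a => Set.indicator_le_self' (by simp) a

theorem toOuterMeasure_bind_le {A B : Type*} (P : PMF A) (f : A → PMF B) (s : Set B)
    {ε : ENNReal} (h : ∀ a, (f a).toOuterMeasure s ≤ ε) : (P.bind f).toOuterMeasure s ≤ ε := by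
  rw [toOuterMeasure_bind_apply]
  calc ∑' a, P a * (f a).toOuterMeasure s ≤ ∑' a, P a * ε :=
        ENNReal.tsum_le_tsum fun a => mul_le_mul_right (h a) _
    _ = ε := by rw [ENNReal.tsum_mul_right, P.tsum_coe, one_mul]

theorem toOuterMeasure_uniformOfFintype_le {A : Type*} [Fintype A] [Nonempty A] (s : Set A) {k : ℕ}
    (S : Finset A) (hs : s ⊆ S) (hS : S.card ≤ k) :
    (uniformOfFintype A).toOuterMeasure s ≤ k / Fintype.card A := by
  classical
  rw [toOuterMeasure_uniformOfFintype_apply]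
  refine ENNReal.div_le_div_right ?_ _
  have : Fintype.card s ≤ k := by
    rw [← Set.toFinset_card]
    refine (Finset.card_le_card ?_).trans hS
    intro a ha
    exact hs (by simpa using ha)
  exact_mod_cast this

end PMF

/-- Two experiments that only differ on an event `B` are close in statistical distance. -/
theorem statDist_bind_le {Z Ω : Type} (P : PMF Z) (g g' : Z → PMF Ω) (B : Set Z)
    (h : ∀ z, z ∉ B → g z = g' z) :
    statDist (P.bind g) (P.bind g') ≤ (P.toOuterMeasure B).toReal := by
  classical
  have hB : P.toOuterMeasure B ≠ ⊤ := ((P.toOuterMeasure_le_one B).trans_lt ENNReal.one_lt_top).ne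
  -- The part of an experiment that passes through `B` has total mass `P B`, whatever the
  -- continuation is.
  have mass : ∀ f : Z → PMF Ω, ∑' ω, ∑' z, B.indicator P z * f z ω = P.toOuterMeasure B := by
    intro f
    rw [ENNReal.tsum_comm]
    simp only [ENNReal.tsum_mul_left, PMF.tsum_coe, mul_one, PMF.toOuterMeasure_apply]
  have fin : ∀ (f : Z → PMF Ω) ω, ∑' z, B.indicator P z * f z ω ≠ ⊤ := fun f =>
    ENNReal.ne_top_of_tsum_ne_top (by rw [mass]; exact hB)
  have summ : ∀ f : Z → PMF Ω, Summable fun ω => (∑' z, B.indicator P z * f z ω).toReal := fun f =>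
    ENNReal.summable_toReal (by rw [mass]; exact hB)
  have split : ∀ (f : Z → PMF Ω) ω, P.bind f ω =
      ∑' z, B.indicator P z * f z ω + ∑' z, Bᶜ.indicator P z * f z ω := by
    intro f ω
    rw [PMF.bind_apply, ← ENNReal.tsum_add]
    refine tsum_congr fun z => ?_
    rw [← add_mul]
    by_cases hz : z ∈ B <;> simp [hz]
  have same : ∀ ω, ∑' z, Bᶜ.indicator P z * g z ω = ∑' z, Bᶜ.indicator P z * g' z ω := by
    intro ω
    refine tsum_congr fun z => ?_
    by_cases hz : z ∈ B
    · simp [hz]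
    · rw [h z hz]
  have fin' : ∀ ω, ∑' z, Bᶜ.indicator P z * g z ω ≠ ⊤ := fun ω hω => by
    have := split g ω
    rw [hω, add_top] at this
    exact (P.bind g).apply_ne_top ω this
  have bound : ∀ ω, |(P.bind g ω).toReal - (P.bind g' ω).toReal| ≤
      (∑' z, B.indicator P z * g z ω).toReal + (∑' z, B.indicator P z * g' z ω).toReal := by
    intro ω
    rw [split g, split g', ← same, ENNReal.toReal_add (fin g ω) (fin' ω),
      ENNReal.toReal_add (fin g' ω) (fin' ω), add_sub_add_right_eq_sub]
    refine (abs_sub _ _).trans ?_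
    rw [abs_of_nonneg ENNReal.toReal_nonneg, abs_of_nonneg ENNReal.toReal_nonneg]
  have total : ∀ f : Z → PMF Ω, ∑' ω, (∑' z, B.indicator P z * f z ω).toReal =
      (P.toOuterMeasure B).toReal := fun f => by
    rw [← mass f, ENNReal.tsum_toReal_eq (fin f)]
  unfold statDist
  have hs := (summ g).add (summ g')
  -- Each experiment contributes at most `P B`; the factor `1 / 2` of `statDist` absorbs the
  -- doubling.
  have : ∑' ω, |(P.bind g ω).toReal - (P.bind g' ω).toReal| ≤
      (P.toOuterMeasure B).toReal + (P.toOuterMeasure B).toReal := by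
    rw [← total g]
    nth_rewrite 2 [total g]
    rw [← total g', ← (summ g).tsum_add (summ g')]
    exact (Summable.of_nonneg_of_le (fun _ => abs_nonneg _) bound hs).tsum_le_tsum bound hs
  linarith

namespace AuthPIR

open Polynomial

/-! ### The database polynomial, its gradient and its restriction to curves -/

section Encoding

variable {S S' : Type*} [CommRing S] [CommRing S'] {n d N t : ℕ}

/-- The database polynomial `∑ i, X i * ∏ c, y (c, idx i c)` together with its gradient. -/
def evalMap (idx : Fin n → Fin d → Fin N) (X : Fin n → S) (y : Fin d × Fin N → S) :
    Option (Fin d × Fin N) → S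
  | none => ∑ i, X i * ∏ c, y (c, idx i c)
  | some k => ∑ i, if idx i k.1 = k.2 then X i * ∏ c ∈ Finset.univ.erase k.1, y (c, idx i c) else 0

/-- The point of the affine space that stands for the index `α`. -/
def indexPoint (S : Type*) [CommRing S] (idx : Fin n → Fin d → Fin N) (α : Fin n) :
    Fin d × Fin N → S :=
  fun k => if idx α k.1 = k.2 then 1 else 0

/-- The point with parameter `z` on the curve with coefficients `w`. -/
def curve {K : Type*} (w : Fin (t + 1) → K → S) (z : S) : K → S :=
  fun k => ∑ e : Fin (t + 1), z ^ (e : ℕ) * w e k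

/-- Applied to evaluation homomorphisms on `S[X]`, this identifies restriction to a curve followed
by evaluation with evaluation at the point. -/
theorem map_evalMap (φ : S →+* S') (idx : Fin n → Fin d → Fin N) (X : Fin n → S)
    (y : Fin d × Fin N → S) (o : Option (Fin d × Fin N)) :
    φ (evalMap idx X y o) = evalMap idx (fun i => φ (X i)) (fun k => φ (y k)) o := by
  cases o with
  | none => simp [evalMap, map_sum, map_prod]
  | some k =>
    simp only [evalMap, map_sum]
    refine Finset.sum_congr rfl fun i _ => ?_
    split_ifs <;> simp [map_prod]

/-- For `i ≠ α` the words of `i` and `α` differ in some letter, and the factor at that letter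
vanishes. -/
theorem evalMap_indexPoint {idx : Fin n → Fin d → Fin N} (hidx : Function.Injective idx)
    (X : Fin n → S) (α : Fin n) : evalMap idx X (indexPoint S idx α) none = X α := by
  simp only [evalMap, indexPoint]
  rw [Finset.sum_eq_single α]
  · simp
  · intro i _ hi
    obtain ⟨c, hc⟩ := Function.ne_iff.1 (hidx.ne hi)
    rw [Finset.prod_eq_zero (Finset.mem_univ c) (if_neg (Ne.symm hc)), mul_zero]
  · simp

theorem derivative_evalMap (idx : Fin n → Fin d → Fin N) (X : Fin n → S)
    (y : Fin d × Fin N → S[X]) :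
    derivative (evalMap idx (fun i => C (X i)) y none) =
      ∑ k, evalMap idx (fun i => C (X i)) y (some k) * derivative (y k) := by
  simp only [evalMap, derivative_sum, derivative_mul, derivative_C, zero_mul, zero_add,
    derivative_prod_finset, Finset.sum_mul]
  rw [Finset.sum_comm]
  refine Finset.sum_congr rfl fun i _ => ?_
  rw [Fintype.sum_prod_type, Finset.mul_sum]
  refine Finset.sum_congr rfl fun c _ => ?_
  rw [Finset.sum_eq_single (idx i c)]
  · simp [mul_assoc]
  · intro a _ ha
    simp [ha.symm]
  · simp

theorem eval_curve {K : Type*} (w : Fin (t + 1) → K → S) (z : S) (k : K) :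
    (curve (fun e k => C (w e k)) X k).eval z = curve w z k := by
  simp only [curve, eval_finsetSum]
  exact Finset.sum_congr rfl fun e _ => by rw [eval_mul, eval_pow, eval_X, eval_C]

theorem natDegree_curve_le {K : Type*} (w : Fin (t + 1) → K → S) (k : K) :
    (curve (fun e k => C (w e k)) X k).natDegree ≤ t := by
  refine natDegree_sum_le_of_forall_le _ _ fun e _ => ?_
  rw [mul_comm]
  exact (natDegree_C_mul_X_pow_le _ _).trans (by omega)

theorem curve_zero {K : Type*} (w : Fin (t + 1) → K → S) : curve w 0 = w 0 := by
  funext k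
  rw [curve, Fin.sum_univ_succ]
  simp

theorem natDegree_evalMap_le (idx : Fin n → Fin d → Fin N) (X : Fin n → S)
    (y : Fin d × Fin N → S[X]) (hy : ∀ k, (y k).natDegree ≤ t) (o : Option (Fin d × Fin N)) :
    (evalMap idx (fun i => C (X i)) y o).natDegree ≤ t * d := by
  have hprod : ∀ (i : Fin n) (s : Finset (Fin d)),
      (C (X i) * ∏ c ∈ s, y (c, idx i c)).natDegree ≤ t * d := by
    intro i s
    refine (natDegree_C_mul_le _ _).trans ((natDegree_prod_le _ _).trans ?_)
    refine (Finset.sum_le_card_nsmul _ _ t fun c _ => hy _).trans ?_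
    rw [smul_eq_mul, mul_comm]
    exact Nat.mul_le_mul_left _ (s.card_le_univ.trans (by simp))
  cases o with
  | none => exact natDegree_sum_le_of_forall_le _ _ fun i _ => hprod i _
  | some k =>
    refine natDegree_sum_le_of_forall_le _ _ fun i _ => ?_
    beta_reduce
    split_ifs
    · exact hprod i _
    · simp

/-- The coefficients of the restriction of `evalMap` to a curve. -/
noncomputable def curveCoeff (idx : Fin n → Fin d → Fin N) (X : Fin n → S)
    (w : Fin (t + 1) → Fin d × Fin N → S) (j : ℕ) (o : Option (Fin d × Fin N)) : S :=
  (evalMap idx (fun i => C (X i)) (curve (fun e k => C (w e k)) Polynomial.X) o).coeff j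

/-- This is why honest servers pass the test: the `t * d + 1` transmitted coefficients determine the
restriction at every parameter. -/
theorem sum_curveCoeff (idx : Fin n → Fin d → Fin N) (X : Fin n → S)
    (w : Fin (t + 1) → Fin d × Fin N → S) (z : S) (o : Option (Fin d × Fin N)) :
    ∑ j : Fin (t * d + 1), z ^ (j : ℕ) * curveCoeff idx X w j o = evalMap idx X (curve w z) o := by
  have h := map_evalMap (evalRingHom z) idx (fun i => C (X i))
    (curve (fun e k => C (w e k)) Polynomial.X) o
  simp only [coe_evalRingHom, eval_C, eval_curve] at h
  have h2 : evalMap idx X (fun k => curve w z k) o = evalMap idx X (curve w z) o := rfl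
  rw [← h2, ← h, eval_eq_sum_range' (n := t * d + 1)
    (Nat.lt_succ_of_le (natDegree_evalMap_le idx X _ (natDegree_curve_le w) o)),
    ← Fin.sum_univ_eq_sum_range fun j => (evalMap idx (fun i => C (X i))
      (curve (fun e k => C (w e k)) Polynomial.X) o).coeff j * z ^ j]
  exact Finset.sum_congr rfl fun j _ => mul_comm _ _

theorem curveCoeff_zero (idx : Fin n → Fin d → Fin N) (X : Fin n → S)
    (w : Fin (t + 1) → Fin d × Fin N → S) (o : Option (Fin d × Fin N)) :
    curveCoeff idx X w 0 o = evalMap idx X (w 0) o := by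
  rw [← curve_zero w, ← sum_curveCoeff, Fin.sum_univ_succ]
  simp

end Encoding

/-! ### Interpolation by curves and Hermite interpolation -/

section Interpolation

variable {F : Type*} [Field F] {ι : Type*} {t : ℕ}

/-- Curves of degree `t` through a given point interpolate `t` values at nonzero parameters. -/
theorem exists_curve_eq {K : Type*} (T : Finset ι) (hT : T.card ≤ t) (z : ι → F)
    (hz : Set.InjOn z T) (hz0 : ∀ i ∈ T, z i ≠ 0) (a : K → F) (b : ι → K → F) :
    ∃ R : Fin t → K → F, ∀ i ∈ T, curve (Fin.cons a R : Fin (t + 1) → K → F) (z i) = b i := by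
  classical
  -- The constant term is prescribed to be `a`, so the remaining coefficients must interpolate `(b -
  -- a) / z`; this is where the nodes have to be nonzero.
  let Q : K → F[X] := fun k => Lagrange.interpolate T z fun i => (b i k - a k) / z i
  refine ⟨fun e k => (Q k).coeff e, fun i hi => ?_⟩
  funext k
  have hdeg : (Q k).degree < t :=
    (Lagrange.degree_interpolate_lt _ hz).trans_le (by exact_mod_cast hT)
  have hev : (Q k).eval (z i) = (b i k - a k) / z i :=
    Lagrange.eval_interpolate_at_node _ hz hi
  have hsum : (Q k).eval (z i) = ∑ e : Fin t, (Q k).coeff e * z i ^ (e : ℕ) := by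
    by_cases h0 : Q k = 0
    · simp [h0]
    · rw [eval_eq_sum_range' ((natDegree_lt_iff_degree_lt h0).2 hdeg),
        ← Fin.sum_univ_eq_sum_range fun e => (Q k).coeff e * z i ^ e]
  have hmul : ∑ e : Fin t, z i ^ ((e : ℕ) + 1) * (Q k).coeff e = z i * (Q k).eval (z i) := by
    rw [hsum, Finset.mul_sum]
    exact Finset.sum_congr rfl fun e _ => by ring
  rw [curve, Fin.sum_univ_succ]
  simp only [Fin.val_zero, pow_zero, one_mul, Fin.cons_zero, Fin.val_succ, Fin.cons_succ]
  rw [hmul, hev, mul_div_cancel₀ _ (hz0 i hi)]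
  ring

/-- A nonzero difference would have a double root at every node, hence degree at least `2 * card ι`.
The double-root criterion by the first derivative is valid in characteristic two as well. -/
theorem eq_of_hermite [Fintype ι] {z : ι → F} (hz : Function.Injective z) {P Q : F[X]}
    (hP : P.natDegree < 2 * Fintype.card ι) (hQ : Q.natDegree < 2 * Fintype.card ι)
    (h0 : ∀ i, P.eval (z i) = Q.eval (z i))
    (h1 : ∀ i, (derivative P).eval (z i) = (derivative Q).eval (z i)) : P = Q := by
  by_contra hne
  have hD : P - Q ≠ 0 := sub_ne_zero.2 hne
  have hdvd : ∏ i, (X - C (z i)) ^ 2 ∣ P - Q := by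
    refine Finset.prod_dvd_of_coprime ?_ fun i _ => ?_
    · intro i _ j _ hij
      exact (pairwise_coprime_X_sub_C hz hij).pow
    · refine (pow_dvd_pow _ ?_).trans (pow_rootMultiplicity_dvd (P - Q) (z i))
      exact (one_lt_rootMultiplicity_iff_isRoot hD).2
        ⟨by simp [h0 i], by simp [h1 i]⟩
  have hdeg := natDegree_le_of_dvd hdvd hD
  rw [natDegree_prod_of_monic _ _ fun i _ => (monic_X_sub_C _).pow 2] at hdeg
  simp only [natDegree_pow, natDegree_X_sub_C, mul_one, Finset.sum_const, Finset.card_univ,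
    smul_eq_mul] at hdeg
  have := natDegree_sub_le P Q
  have := max_lt hP hQ
  omega

open Classical in
/-- The polynomial of degree less than `2 * card ι` with prescribed values `u` and derivatives `u'`
at the nodes `z` (or `0`, if there is none). -/
noncomputable def hermite [Fintype ι] (z u u' : ι → F) : F[X] :=
  if h : ∃ P : F[X], P.natDegree < 2 * Fintype.card ι ∧
    ∀ i, P.eval (z i) = u i ∧ (derivative P).eval (z i) = u' i then h.choose else 0

/-- Uniqueness suffices: for honest data the restriction to the curve itself witnesses existence. -/
theorem hermite_eq [Fintype ι] {z u u' : ι → F} (hz : Function.Injective z) {P : F[X]}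
    (hP : P.natDegree < 2 * Fintype.card ι)
    (h : ∀ i, P.eval (z i) = u i ∧ (derivative P).eval (z i) = u' i) : hermite z u u' = P := by
  have hex : ∃ P : F[X], P.natDegree < 2 * Fintype.card ι ∧
    ∀ i, P.eval (z i) = u i ∧ (derivative P).eval (z i) = u' i := ⟨P, hP, h⟩
  rw [hermite, dif_pos hex]
  have hc := hex.choose_spec
  exact eq_of_hermite hz hc.1 hP (fun i => (hc.2 i).1.trans (h i).1.symm)
    fun i => (hc.2 i).2.trans (h i).2.symm

/-- The retrieved value is the value at `0` of the polynomial that interpolates the values and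
derivatives along the curve. -/
theorem hermite_evalMap [Fintype ι] {n d N : ℕ} {idx : Fin n → Fin d → Fin N}
    (hidx : Function.Injective idx) (X : Fin n → F) {z : ι → F} (hz : Function.Injective z)
    (hd : t * d < 2 * Fintype.card ι) (w : Fin (t + 1) → Fin d × Fin N → F) (α : Fin n)
    (hw : w 0 = indexPoint F idx α) :
    (hermite z (fun i => evalMap idx X (curve w (z i)) none)
      (fun i => ∑ k, evalMap idx X (curve w (z i)) (some k) *
        (derivative (curve (fun e k => C (w e k)) Polynomial.X k)).eval (z i))).eval 0 = X α := by
  have hev : ∀ (x : F) (o : Option (Fin d × Fin N)), (evalMap idx (fun i => C (X i))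
      (curve (fun e k => C (w e k)) Polynomial.X) o).eval x = evalMap idx X (curve w x) o := by
    intro x o
    have h := map_evalMap (evalRingHom x) idx (fun i => C (X i))
      (curve (fun e k => C (w e k)) Polynomial.X) o
    simpa only [coe_evalRingHom, eval_C, eval_curve] using h
  rw [hermite_eq hz
    ((natDegree_evalMap_le idx X _ (natDegree_curve_le w) none).trans_lt hd) fun i => ⟨hev _ _, ?_⟩,
    hev, curve_zero, hw, evalMap_indexPoint hidx]
  rw [derivative_evalMap, eval_finsetSum]
  exact Finset.sum_congr rfl fun k _ => by rw [eval_mul, hev]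

end Interpolation

/-! ### The field, its bit representation and the evaluation points -/

section Field

variable {ℓ σ : ℕ}

/-- The field with `2 ^ (σ + 1 + ℓ)` elements. -/
abbrev GF (ℓ σ : ℕ) : Type := GaloisField 2 (σ + 1 + ℓ)

noncomputable instance : Fintype (GF ℓ σ) := Fintype.ofFinite _

/-- A basis of the field over `𝔽₂`. -/
noncomputable def gfBasis (ℓ σ : ℕ) : Module.Basis (Fin (σ + 1 + ℓ)) (ZMod 2) (GF ℓ σ) :=
  Module.finBasisOfFinrankEq _ _ (GaloisField.finrank 2 (by omega))

/-- The bits of a field element. -/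
noncomputable def fieldBits (ℓ σ : ℕ) : GF ℓ σ ≃ Bits (σ + 1 + ℓ) :=
  (gfBasis ℓ σ).equivFun.toEquiv.trans (Equiv.arrowCongr (Equiv.refl _) bitEquiv.symm)

theorem bitEquiv_fieldBits (x : GF ℓ σ) (pos : Fin (σ + 1 + ℓ)) :
    bitEquiv (fieldBits ℓ σ x pos) = (gfBasis ℓ σ).coord pos x := by
  simp [fieldBits]

theorem fieldBits_symm (b : Bits (σ + 1 + ℓ)) :
    (fieldBits ℓ σ).symm b = ∑ pos, if b pos = true then gfBasis ℓ σ pos else 0 := by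
  simp only [fieldBits, Equiv.symm_trans_apply, Equiv.arrowCongr_symm, Equiv.symm_symm]
  change (gfBasis ℓ σ).equivFun.symm _ = _
  rw [Module.Basis.equivFun_symm_apply]
  refine Finset.sum_congr rfl fun pos _ => ?_
  cases h : b pos <;> simp [Equiv.arrowCongr, bitEquiv, h]

/-- The evaluation points that are reserved for the server `h`. -/
noncomputable def node (h : Fin ℓ) (r : Fin (σ + 1) → ZMod 2) : GF ℓ σ :=
  -- The last `ℓ` coordinates name the server, which makes nodes nonzero and distinct across
  -- servers; the first `σ + 1` leave `2^(σ+1)` choices to each server.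
  (gfBasis ℓ σ).equivFun.symm (Fin.append r (Pi.single h 1))

theorem node_inj {h h' : Fin ℓ} {r r' : Fin (σ + 1) → ZMod 2} (e : node h r = node h' r') :
    h = h' ∧ r = r' := by
  have e := (gfBasis ℓ σ).equivFun.symm.injective e
  constructor
  · have := congrFun e (Fin.natAdd (σ + 1) h)
    rw [Fin.append_right, Fin.append_right, Pi.single_eq_same] at this
    by_contra hne
    rw [Pi.single_eq_of_ne hne] at this
    exact one_ne_zero this
  · funext i
    simpa using congrFun e (Fin.castAdd ℓ i)

theorem node_ne_zero (h : Fin ℓ) (r : Fin (σ + 1) → ZMod 2) : node h r ≠ 0 := by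
  intro e
  have e := (gfBasis ℓ σ).equivFun.symm.map_eq_zero_iff.1 e
  have := congrFun e (Fin.natAdd (σ + 1) h)
  rw [Fin.append_right, Pi.single_eq_same] at this
  exact one_ne_zero this

theorem node_injective (r : Fin ℓ → Fin (σ + 1) → ZMod 2) :
    Function.Injective fun h => node h (r h) := fun _ _ e => (node_inj e).1

/-- The positions of the bits of a family of field elements. -/
noncomputable def bitIndex (ℓ σ : ℕ) (I : Type) [Fintype I] :
    I × Fin (σ + 1 + ℓ) ≃ Fin (Fintype.card I * (σ + 1 + ℓ)) :=
  ((Fintype.equivFin I).prodCongr (Equiv.refl _)).trans finProdFinEquiv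

/-- Families of field elements as bit strings. -/
noncomputable def pack (ℓ σ : ℕ) (I : Type) [Fintype I] :
    (I → GF ℓ σ) ≃ Bits (Fintype.card I * (σ + 1 + ℓ)) where
  toFun f b := fieldBits ℓ σ (f ((bitIndex ℓ σ I).symm b).1) ((bitIndex ℓ σ I).symm b).2
  invFun v i := (fieldBits ℓ σ).symm fun pos => v (bitIndex ℓ σ I (i, pos))
  left_inv f := by
    funext i
    simp
  right_inv v := by
    funext b
    simp

/-- The field elements that represent a block. -/
noncomputable def encBlock (ℓ σ : ℕ) {m : ℕ} (b : Bits m) : Fin (m / (σ + 1 + ℓ) + 1) → GF ℓ σ :=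
  fun c => (fieldBits ℓ σ).symm fun pos =>
    -- The block is padded with `false` beyond its `m` bits.
    if h : (c : ℕ) * (σ + 1 + ℓ) + pos < m then b ⟨_, h⟩ else false

/-- The block that is represented by given field elements. -/
noncomputable def decBlock {m : ℕ} (z : Fin (m / (σ + 1 + ℓ) + 1) → GF ℓ σ) : Bits m :=
  fun j => fieldBits ℓ σ
    (z ⟨j / (σ + 1 + ℓ), Nat.lt_succ_of_le (Nat.div_le_div_right j.2.le)⟩)
    ⟨j % (σ + 1 + ℓ), Nat.mod_lt _ (by omega)⟩

theorem decBlock_encBlock {m : ℕ} (b : Bits m) : decBlock (encBlock ℓ σ b) = b := by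
  funext j
  simp only [decBlock, encBlock, Equiv.apply_symm_apply, Nat.div_add_mod']
  simp

/-- A union bound over `i`: a nonzero `P i` has at most `D` roots, and distinct `r` give distinct
nodes. -/
theorem toOuterMeasure_isRoot_le {ℓ σ : ℕ} (h : Fin ℓ) (P : Fin ℓ → (GF ℓ σ)[X]) {D : ℕ}
    (hP : ∀ i, (P i).natDegree ≤ D) :
    (PMF.uniformOfFintype (Fin ℓ → Fin (σ + 1) → ZMod 2)).toOuterMeasure
      {c | ∃ i, P i ≠ 0 ∧ (P i).IsRoot (node h (c i))} ≤ ℓ * (D / 2 ^ (σ + 1)) := by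
  classical
  have hsub : {c : Fin ℓ → Fin (σ + 1) → ZMod 2 | ∃ i, P i ≠ 0 ∧ (P i).IsRoot (node h (c i))} ⊆
      ⋃ i ∈ (Finset.univ : Finset (Fin ℓ)),
        (fun c => c i) ⁻¹' {r | P i ≠ 0 ∧ (P i).IsRoot (node h r)} := by
    rintro c ⟨i, hi⟩
    simpa using ⟨i, hi⟩
  refine (MeasureTheory.measure_mono hsub).trans
    ((MeasureTheory.measure_biUnion_finset_le _ _).trans ?_)
  refine (Finset.sum_le_card_nsmul _ _ ((D : ENNReal) / 2 ^ (σ + 1)) fun i _ => ?_).trans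
    (by simp)
  have hmap : (PMF.uniformOfFintype (Fin ℓ → Fin (σ + 1) → ZMod 2)).map (fun c => c i) =
      PMF.uniformOfFintype (Fin (σ + 1) → ZMod 2) := by
    conv_rhs => rw [← PMF.map_id (PMF.uniformOfFintype (Fin (σ + 1) → ZMod 2))]
    refine PMF.map_uniformOfFintype_eq (by simp) (by simp) ?_
    rw [Set.range_id]
    exact Set.range_eq_univ.2 fun r => ⟨fun _ => r, rfl⟩
  rw [← PMF.toOuterMeasure_map_apply, hmap]
  have hcard : (Fintype.card (Fin (σ + 1) → ZMod 2) : ENNReal) = 2 ^ (σ + 1) := by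
    simp [ZMod.card]
  rw [← hcard]
  refine PMF.toOuterMeasure_uniformOfFintype_le _
    (Finset.univ.filter fun r => P i ≠ 0 ∧ (P i).IsRoot (node h r)) (by intro r hr; simpa using hr)
    (le_trans ?_ (hP i))
  refine le_trans ?_ ((Multiset.toFinset_card_le _).trans (P i).card_roots')
  refine Finset.card_le_card_of_injOn (node h) ?_ fun r _ r' _ e => (node_inj e).2
  intro r hr
  have hr : P i ≠ 0 ∧ (P i).IsRoot (node h r) := by simpa using hr
  simpa using hr

end Field

/-! ### Queries, answers and the consistency test over the field -/

section Protocol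

variable {ℓ t d σ n N c : ℕ}

/-- The positions of the field elements of a query. -/
abbrev QIdx (ℓ t d N : ℕ) : Type := (Fin (t + 1) ⊕ Fin ℓ) × (Fin d × Fin N)

/-- The positions of the field elements of an answer. -/
abbrev AIdx (ℓ t d N c : ℕ) : Type :=
  (Fin (t * d + 1) ⊕ Fin ℓ) × (Option (Fin d × Fin N) × Fin c)

/-- The secret evaluation points; `r h i` is used to test server `i` with the help of server `h`. -/
abbrev Params (ℓ σ : ℕ) : Type := Fin ℓ → Fin ℓ → Fin (σ + 1) → ZMod 2

/-- The coefficients of the curve through the retrieved index, and those of the curves through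
the points that are queried. -/
abbrev Masks (ℓ t d σ N : ℕ) : Type :=
  (Fin t → Fin d × Fin N → GF ℓ σ) × (Fin ℓ → Fin t → Fin d × Fin N → GF ℓ σ)

/-- The random coins of the client. -/
abbrev Rand (ℓ t d σ N : ℕ) : Type := Params ℓ σ × Masks ℓ t d σ N

/-- The curve through the retrieved index. -/
noncomputable def clientCurve (idx : Fin n → Fin d → Fin N) (α : Fin n) (a : Masks ℓ t d σ N) :
    Fin (t + 1) → Fin d × Fin N → GF ℓ σ :=
  Fin.cons (indexPoint _ idx α) a.1

/-- The curve that is sent to server `i`; it starts on the curve through the retrieved index. -/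
noncomputable def serverCurve (idx : Fin n → Fin d → Fin N) (α : Fin n) (a : Masks ℓ t d σ N)
    (i : Fin ℓ) : Fin (t + 1) → Fin d × Fin N → GF ℓ σ :=
  -- The base parameters `node i 0` are fixed; the secret parameters serve only for the tests.
  Fin.cons (curve (clientCurve idx α a) (node i 0)) (a.2 i)

/-- The query to server `i`: its own curve and one point on the curve of each server. -/
noncomputable def query (W : Fin ℓ → Fin (t + 1) → Fin d × Fin N → GF ℓ σ) (r : Params ℓ σ)
    (i : Fin ℓ) : QIdx ℓ t d N → GF ℓ σ
  | (Sum.inl e, k) => W i e k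
  | (Sum.inr j, k) => curve (W j) (node i (r i j)) k

/-- The honest answer to a query. -/
noncomputable def respond (idx : Fin n → Fin d → Fin N) (X : Fin n → Fin c → GF ℓ σ)
    (q : QIdx ℓ t d N → GF ℓ σ) : AIdx ℓ t d N c → GF ℓ σ
  | (Sum.inl j, o, b) => curveCoeff idx (fun i => X i b) (fun e k => q (Sum.inl e, k)) j o
  | (Sum.inr j, o, b) => evalMap idx (fun i => X i b) (fun k => q (Sum.inr j, k)) o

/-- The test of the client: the answer of every server on its own curve is consistent with the
answers of all servers on their points of this curve. -/
def Accept (r : Params ℓ σ) (A : Fin ℓ → AIdx ℓ t d N c → GF ℓ σ) : Prop :=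
  ∀ i h o b, ∑ j : Fin (t * d + 1), node h (r h i) ^ (j : ℕ) * A i (Sum.inl j, o, b) =
    A h (Sum.inr i, o, b)

/-- The field elements that the client recovers from the answers. -/
noncomputable def reconstruct (idx : Fin n → Fin d → Fin N) (α : Fin n) (a : Masks ℓ t d σ N)
    (A : Fin ℓ → AIdx ℓ t d N c → GF ℓ σ) (b : Fin c) : GF ℓ σ :=
  (hermite (fun i : Fin ℓ => node i 0) (fun i => A i (Sum.inl 0, none, b))
    (fun i => ∑ k, A i (Sum.inl 0, some k, b) *
      (derivative (curve (fun e k => C (clientCurve idx α a e k)) X k)).eval (node i 0))).eval 0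

theorem accept_respond (idx : Fin n → Fin d → Fin N) (X : Fin n → Fin c → GF ℓ σ)
    (W : Fin ℓ → Fin (t + 1) → Fin d × Fin N → GF ℓ σ) (r : Params ℓ σ) :
    Accept r fun i => respond idx X (query W r i) := by
  intro i h o b
  simp only [respond, query, sum_curveCoeff]

/-- The constant coefficient of an honest restriction is the value or gradient at the start of the
server's curve, which is the server's point on the client's curve. -/
theorem reconstruct_respond {idx : Fin n → Fin d → Fin N} (hidx : Function.Injective idx)
    (hd : t * d < 2 * ℓ) (X : Fin n → Fin c → GF ℓ σ) (α : Fin n) (a : Masks ℓ t d σ N)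
    (r : Params ℓ σ) :
    reconstruct idx α a (fun i => respond idx X (query (serverCurve idx α a) r i)) = X α := by
  funext b
  simp only [reconstruct, respond, query, Fin.val_zero, curveCoeff_zero, serverCurve, Fin.cons_zero]
  exact hermite_evalMap hidx (fun i => X i b) (node_injective 0) (by simpa using hd)
    (clientCurve idx α a) α (by simp [clientCurve])

/-- The polynomial by which a claimed restriction to a curve deviates from the honest one. -/
noncomputable def deviation (A A' : AIdx ℓ t d N c → GF ℓ σ) (o : Option (Fin d × Fin N))
    (b : Fin c) : (GF ℓ σ)[X] :=
  ∑ j : Fin (t * d + 1), C (A (Sum.inl j, o, b) - A' (Sum.inl j, o, b)) * X ^ (j : ℕ)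

theorem natDegree_deviation_le (A A' : AIdx ℓ t d N c → GF ℓ σ) (o : Option (Fin d × Fin N))
    (b : Fin c) : (deviation A A' o b).natDegree ≤ t * d :=
  natDegree_sum_le_of_forall_le _ _ fun j _ =>
    (natDegree_C_mul_X_pow_le _ _).trans (Nat.lt_succ_iff.1 j.2)

theorem coeff_deviation (A A' : AIdx ℓ t d N c → GF ℓ σ) (o : Option (Fin d × Fin N))
    (b : Fin c) (j : Fin (t * d + 1)) :
    (deviation A A' o b).coeff j = A (Sum.inl j, o, b) - A' (Sum.inl j, o, b) := by
  rw [deviation, finsetSum_coeff, Finset.sum_eq_single j]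
  · rw [coeff_C_mul_X_pow, if_pos rfl]
  · intro j' _ hj
    rw [coeff_C_mul_X_pow, if_neg]
    exact fun e => hj (Fin.ext e.symm)
  · simp

theorem eval_deviation (A A' : AIdx ℓ t d N c → GF ℓ σ) (o : Option (Fin d × Fin N))
    (b : Fin c) (z : GF ℓ σ) :
    (deviation A A' o b).eval z = ∑ j : Fin (t * d + 1), z ^ (j : ℕ) * A (Sum.inl j, o, b) -
      ∑ j : Fin (t * d + 1), z ^ (j : ℕ) * A' (Sum.inl j, o, b) := by
  rw [deviation, eval_finsetSum, ← Finset.sum_sub_distrib]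
  refine Finset.sum_congr rfl fun j _ => ?_
  simp only [eval_mul, eval_C, eval_pow, eval_X]
  ring

/-- If tampered answers are accepted, then a secret evaluation point of the honest server `h` is a
root of a deviation polynomial. -/
theorem exists_isRoot_deviation {r : Params ℓ σ} {A A' : Fin ℓ → AIdx ℓ t d N c → GF ℓ σ}
    (hA : Accept r A) (hA' : Accept r A') {h : Fin ℓ} (hh : A h = A' h) (hne : A ≠ A') :
    ∃ i, (∃ o b, deviation (A i) (A' i) o b ≠ 0) ∧
      ∀ o b, (deviation (A i) (A' i) o b).IsRoot (node h (r h i)) := by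
  by_contra! hcon
  have hroot : ∀ i o b, (deviation (A i) (A' i) o b).IsRoot (node h (r h i)) := by
    intro i o b
    rw [IsRoot.def, eval_deviation, hA i h o b, hA' i h o b, hh, sub_self]
  have hzero : ∀ i o b, deviation (A i) (A' i) o b = 0 := by
    intro i
    by_contra! hc
    obtain ⟨o, b, hb⟩ := hcon i hc
    exact hb (hroot i o b)
  have hinl : ∀ i j o b, A i (Sum.inl j, o, b) = A' i (Sum.inl j, o, b) := by
    intro i j o b
    have := coeff_deviation (A i) (A' i) o b j
    rw [hzero, coeff_zero] at this
    exact (sub_eq_zero.1 this.symm)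
  refine hne (funext fun i => funext ?_)
  rintro ⟨j | j, o, b⟩
  · exact hinl i j o b
  -- Once the curve answers agree, acceptance determines the point answers, so these cannot be
  -- tampered with separately.
  · rw [← hA j i o b, ← hA' j i o b]
    simp only [hinl]

end Protocol

/-! ### The scheme on bit strings: correctness and integrity -/

section Scheme

/-- The block of field elements that represents a database. -/
noncomputable abbrev encDatabase (ℓ σ : ℕ) {n m : ℕ} (x : Database n m) :
    Fin n → Fin (m / (σ + 1 + ℓ) + 1) → GF ℓ σ :=
  fun i => encBlock ℓ σ (x i)

open Classical in
/-- The authenticated private information retrieval scheme over the fields with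
`2 ^ (σ κ + 1 + ℓ)` elements, for the encodings `idx n` of the indices. -/
noncomputable def scheme (ℓ t d : ℕ) (σ N : ℕ → ℕ) (idx : ∀ n, Fin n → Fin d → Fin (N n)) :
    Scheme ℓ where
  qlen κ n := Fintype.card (QIdx ℓ t d (N n)) * (σ κ + 1 + ℓ)
  alen κ n m := Fintype.card (AIdx ℓ t d (N n) (m / (σ κ + 1 + ℓ) + 1)) * (σ κ + 1 + ℓ)
  Aux κ n := Rand ℓ t d (σ κ) (N n) × Fin n
  Que κ n α := (PMF.uniformOfFintype (Rand ℓ t d (σ κ) (N n))).map fun ω =>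
    (fun i => pack ℓ (σ κ) (QIdx ℓ t d (N n)) (query (serverCurve (idx n) α ω.2) ω.1 i), (ω, α))
  Ans κ n _ x q := pack ℓ (σ κ) _
    (respond (idx n) (encDatabase ℓ (σ κ) x) ((pack ℓ (σ κ) (QIdx ℓ t d (N n))).symm q))
  Rec κ n _ A aux :=
    let A' := fun i => (pack ℓ (σ κ) _).symm (A i)
    if Accept aux.1.1 A' then some (decBlock (reconstruct (idx n) aux.2 aux.1.2 A')) else none

variable {ℓ t d : ℕ} {σ N : ℕ → ℕ} {idx : ∀ n, Fin n → Fin d → Fin (N n)}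

/-- The query to server `i` as a bit string, as a function of the coins of the client. -/
noncomputable def queryBits (idx : ∀ n, Fin n → Fin d → Fin (N n)) (κ n : ℕ) (α : Fin n)
    (ω : Rand ℓ t d (σ κ) (N n)) (i : Fin ℓ) :
    Bits ((scheme ℓ t d σ N idx).qlen κ n) :=
  pack ℓ (σ κ) (QIdx ℓ t d (N n)) (query (serverCurve (idx n) α ω.2) ω.1 i)

/-- The information that the client keeps: its coins and the retrieved index. -/
def clientAux (κ n : ℕ) (α : Fin n) (ω : Rand ℓ t d (σ κ) (N n)) :
    (scheme ℓ t d σ N idx).Aux κ n := (ω, α)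

/-- The field elements in an answer. -/
noncomputable def answerElems {κ n m : ℕ} (v : Bits ((scheme ℓ t d σ N idx).alen κ n m)) :
    AIdx ℓ t d (N n) (m / (σ κ + 1 + ℓ) + 1) → GF ℓ (σ κ) :=
  (pack ℓ (σ κ) _).symm v

theorem answerElems_injective {κ n m : ℕ} : Function.Injective
    (answerElems (ℓ := ℓ) (t := t) (d := d) (σ := σ) (N := N) (idx := idx) (κ := κ) (n := n)
      (m := m)) := (pack ℓ (σ κ) _).symm.injective

theorem answerElems_ans {κ n m : ℕ} (x : Database n m) (α : Fin n) (ω : Rand ℓ t d (σ κ) (N n))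
    (i : Fin ℓ) :
    answerElems ((scheme ℓ t d σ N idx).Ans κ n m x (queryBits idx κ n α ω i)) =
      respond (idx n) (encDatabase ℓ (σ κ) x) (query (serverCurve (idx n) α ω.2) ω.1 i) := by
  simp [answerElems, scheme, queryBits]

open Classical in
theorem rec_eq {κ n m : ℕ} (A : Fin ℓ → Bits ((scheme ℓ t d σ N idx).alen κ n m)) (α : Fin n)
    (ω : Rand ℓ t d (σ κ) (N n)) :
    (scheme ℓ t d σ N idx).Rec κ n m A (clientAux κ n α ω) =
      if Accept ω.1 (fun i => answerElems (A i)) then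
        some (decBlock (reconstruct (idx n) α ω.2 fun i => answerElems (A i))) else none := rfl

theorem isSome_rec_iff {κ n m : ℕ} (A : Fin ℓ → Bits ((scheme ℓ t d σ N idx).alen κ n m))
    (α : Fin n) (ω : Rand ℓ t d (σ κ) (N n)) :
    ((scheme ℓ t d σ N idx).Rec κ n m A (clientAux κ n α ω)).isSome = true ↔
      Accept ω.1 (fun i => answerElems (A i)) := by
  rw [rec_eq]
  split_ifs with h <;> simp [h]

theorem rec_ans (hidx : ∀ n, Function.Injective (idx n)) (hd : t * d < 2 * ℓ) {κ n m : ℕ}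
    (x : Database n m) (α : Fin n) (ω : Rand ℓ t d (σ κ) (N n)) :
    (scheme ℓ t d σ N idx).Rec κ n m
      (fun i => (scheme ℓ t d σ N idx).Ans κ n m x (queryBits idx κ n α ω i)) (clientAux κ n α ω) =
      some (x α) := by
  rw [rec_eq, if_pos (by simpa only [answerElems_ans] using accept_respond _ _ _ _)]
  simp only [answerElems_ans]
  rw [reconstruct_respond (hidx n) hd, decBlock_encBlock]

theorem que_eq (κ n : ℕ) (α : Fin n) : (scheme ℓ t d σ N idx).Que κ n α =
    (PMF.uniformOfFintype (Rand ℓ t d (σ κ) (N n))).map fun ω =>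
      (queryBits idx κ n α ω, clientAux κ n α ω) := rfl

theorem scheme_correct (hidx : ∀ n, Function.Injective (idx n)) (hd : t * d < 2 * ℓ) :
    (scheme ℓ t d σ N idx).Correct := by
  intro κ n m x α
  rw [que_eq, PMF.map_comp]
  have e : (fun z : (Fin ℓ → Bits ((scheme ℓ t d σ N idx).qlen κ n)) ×
        (scheme ℓ t d σ N idx).Aux κ n => (scheme ℓ t d σ N idx).Rec κ n m
          (fun j => (scheme ℓ t d σ N idx).Ans κ n m x (z.1 j)) z.2) ∘
      (fun ω : Rand ℓ t d (σ κ) (N n) => (queryBits idx κ n α ω, clientAux κ n α ω)) =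
      Function.const _ (some (x α)) := by
    funext ω
    exact rec_ans hidx hd x α ω
  rw [e, PMF.map_const]
  simp

theorem answers_honest (Γ : Scheme ℓ) {κ n m : ℕ} (x : Database n m) (V : Finset (Fin ℓ))
    (q : Fin ℓ → Bits (Γ.qlen κ n)) :
    Γ.answers x V q (fun j : V => Γ.Ans κ n m x (q j)) = fun j => Γ.Ans κ n m x (q j) := by
  funext j
  simp [Scheme.answers]

/-- The coins of the client together with the output of a strategy of the servers in `V`. -/
noncomputable def attack {κ n m : ℕ} (idx : ∀ n, Fin n → Fin d → Fin (N n)) (α : Fin n)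
    (V : Finset (Fin ℓ)) {St : Type}
    (A : (V → Bits ((scheme ℓ t d σ N idx).qlen κ n)) →
      PMF (St × (V → Bits ((scheme ℓ t d σ N idx).alen κ n m)))) :
    PMF (Rand ℓ t d (σ κ) (N n) × St × (V → Bits ((scheme ℓ t d σ N idx).alen κ n m))) :=
  (PMF.uniformOfFintype (Rand ℓ t d (σ κ) (N n))).bind fun ω =>
    (A fun j => queryBits idx κ n α ω j).map fun y => (ω, y)

/-- The event that tampered answers are accepted. -/
def Undetected {κ n m : ℕ} (idx : ∀ n, Fin n → Fin d → Fin (N n)) (x : Database n m) (α : Fin n)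
    (V : Finset (Fin ℓ)) (St : Type) :
    Set (Rand ℓ t d (σ κ) (N n) × St × (V → Bits ((scheme ℓ t d σ N idx).alen κ n m))) :=
  {p | ((scheme ℓ t d σ N idx).Rec κ n m ((scheme ℓ t d σ N idx).answers x V
      (queryBits idx κ n α p.1) p.2.2) (clientAux κ n α p.1)).isSome = true ∧
    p.2.2 ≠ fun j : V => (scheme ℓ t d σ N idx).Ans κ n m x (queryBits idx κ n α p.1 j)}

/-- The parameters `r h` enter the query to server `h` only, so they stay hidden from all the
others. -/
theorem queryBits_update {κ n : ℕ} (α : Fin n) (r : Params ℓ (σ κ)) (a : Masks ℓ t d (σ κ) (N n))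
    {h i : Fin ℓ} (hi : i ≠ h) (c : Fin ℓ → Fin (σ κ + 1) → ZMod 2) :
    queryBits idx κ n α (Function.update r h c, a) i = queryBits idx κ n α (r, a) i := by
  unfold queryBits
  congr 1
  funext ⟨s, k⟩
  cases s <;> simp [query, hi]

/-- Some server `h` lies outside `V`. Its row of test parameters can be redrawn after the coalition
has answered, and accepted tampering then puts a fresh parameter on a root of a polynomial fixed
beforehand. -/
theorem attack_undetected_le {κ n m : ℕ} (x : Database n m) (α : Fin n) {V : Finset (Fin ℓ)}
    (hV : V.card < ℓ) {St : Type}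
    (A : (V → Bits ((scheme ℓ t d σ N idx).qlen κ n)) →
      PMF (St × (V → Bits ((scheme ℓ t d σ N idx).alen κ n m)))) :
    (attack idx α V A).toOuterMeasure (Undetected idx x α V St) ≤
      ℓ * ((t * d : ℕ) / 2 ^ (σ κ + 1)) := by
  classical
  obtain ⟨h, hh⟩ : ∃ h, h ∉ V := by
    by_contra! hc
    have : V = Finset.univ := Finset.eq_univ_of_forall hc
    simp [this] at hV
  have hne : ∀ j : V, (j : Fin ℓ) ≠ h := fun j e => hh (e ▸ j.2)
  -- Deferred sampling: the row of `h` is replaced by a fresh `c`, which is moved past the adversary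
  -- because its input ignores this row.
  have key : attack idx α V A =
      (PMF.uniformOfFintype (Params ℓ (σ κ))).bind fun r =>
        (PMF.uniformOfFintype (Masks ℓ t d (σ κ) (N n))).bind fun a =>
          (A fun j => queryBits idx κ n α (r, a) j).bind fun y =>
            (PMF.uniformOfFintype (Fin ℓ → Fin (σ κ + 1) → ZMod 2)).map fun c =>
              ((Function.update r h c, a), y) := by
    have e1 : attack idx α V A = (PMF.uniformOfFintype (Params ℓ (σ κ))).bind fun r =>
        (PMF.uniformOfFintype (Masks ℓ t d (σ κ) (N n))).bind fun a =>
          (A fun j => queryBits idx κ n α (r, a) j).map fun y => ((r, a), y) := by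
      rw [attack, PMF.uniformOfFintype_prod, PMF.bind_bind]
      simp only [PMF.bind_map]
      rfl
    rw [e1]
    conv_lhs => rw [← PMF.bind_update_uniformOfFintype h, PMF.bind_bind]
    refine congrArg _ (funext fun r => ?_)
    rw [PMF.bind_map]
    change ((PMF.uniformOfFintype (Fin ℓ → Fin (σ κ + 1) → ZMod 2)).bind fun c =>
      (PMF.uniformOfFintype (Masks ℓ t d (σ κ) (N n))).bind fun a =>
        (A fun j => queryBits idx κ n α (Function.update r h c, a) j).map fun y =>
          ((Function.update r h c, a), y)) = _
    simp only [queryBits_update α r _ (hne _)]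
    rw [PMF.bind_comm]
    refine congrArg _ (funext fun a => ?_)
    simp only [← PMF.bind_pure_comp]
    rw [PMF.bind_comm]
    rfl
  rw [key]
  refine PMF.toOuterMeasure_bind_le _ _ _ fun r => PMF.toOuterMeasure_bind_le _ _ _ fun a =>
    PMF.toOuterMeasure_bind_le _ _ _ fun y => ?_
  rw [PMF.toOuterMeasure_map_apply]
  let B : Fin ℓ → AIdx ℓ t d (N n) (m / (σ κ + 1 + ℓ) + 1) → GF ℓ (σ κ) := fun i =>
    if hi : i ∈ V then (pack ℓ (σ κ) _).symm (y.2 ⟨i, hi⟩) else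
      respond (idx n) (encDatabase ℓ (σ κ) x) (query (serverCurve (idx n) α a) r i)
  let B' : Fin ℓ → AIdx ℓ t d (N n) (m / (σ κ + 1 + ℓ) + 1) → GF ℓ (σ κ) := fun i =>
    respond (idx n) (encDatabase ℓ (σ κ) x) (query (serverCurve (idx n) α a) r i)
  -- One nonzero deviation per server is selected, using the old row `r h`; hence `P` does not
  -- depend on `c`, as the root count requires.
  let P : Fin ℓ → (GF ℓ (σ κ))[X] := fun i =>
    if hi : ∃ ob : Option (Fin d × Fin (N n)) × Fin (m / (σ κ + 1 + ℓ) + 1),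
      deviation (B i) (B' i) ob.1 ob.2 ≠ 0 then
      deviation (B i) (B' i) hi.choose.1 hi.choose.2 else 0
  have hP : ∀ i, (P i).natDegree ≤ t * d := by
    intro i
    simp only [P]
    split_ifs
    · exact natDegree_deviation_le _ _ _ _
    · simp
  refine (MeasureTheory.measure_mono ?_).trans (toOuterMeasure_isRoot_le h P hP)
  rintro c ⟨hacc, htam⟩
  have hacc := (isSome_rec_iff _ _ _).1 hacc
  have hq : ∀ i, i ≠ h → query (serverCurve (idx n) α a) (Function.update r h c) i =
      query (serverCurve (idx n) α a) r i := by
    intro i hi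
    funext ⟨s, k⟩
    cases s <;> simp [query, hi]
  set q := queryBits idx κ n α (Function.update r h c, a) with hqdef
  have hhon : ∀ i, answerElems ((scheme ℓ t d σ N idx).Ans κ n m x (q i)) =
      respond (idx n) (encDatabase ℓ (σ κ) x)
        (query (serverCurve (idx n) α a) (Function.update r h c) i) := fun i =>
    answerElems_ans x α (Function.update r h c, a) i
  have hmem : ∀ i (hi : i ∈ V), (scheme ℓ t d σ N idx).answers x V q y.2 i = y.2 ⟨i, hi⟩ :=
    fun i hi => by simp [Scheme.answers, hi]
  have hnot : ∀ i, i ∉ V → (scheme ℓ t d σ N idx).answers x V q y.2 i =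
      (scheme ℓ t d σ N idx).Ans κ n m x (q i) := fun i hi => by simp [Scheme.answers, hi]
  have hne' : (fun i => answerElems ((scheme ℓ t d σ N idx).answers x V q y.2 i)) ≠
      fun i => respond (idx n) (encDatabase ℓ (σ κ) x)
        (query (serverCurve (idx n) α a) (Function.update r h c) i) := by
    intro e
    refine htam (funext fun i => answerElems_injective ?_)
    have := congrFun e i
    beta_reduce at this
    rw [hmem i i.2, ← hhon] at this
    exact this
  obtain ⟨i, ⟨o, b, hob⟩, hroot⟩ := exists_isRoot_deviation hacc (accept_respond _ _ _ _)
    (h := h) (by rw [hnot h hh, hhon]) hne'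
  -- A server with a nonzero deviation is corrupted, hence differs from `h`; so its query, and with
  -- it the honest answer, does not involve `c`.
  have hi : i ∈ V := by
    by_contra hi
    exact hob (by rw [hnot i hi, hhon]; simp [deviation])
  have hih : i ≠ h := hne ⟨i, hi⟩
  have hB : answerElems ((scheme ℓ t d σ N idx).answers x V q y.2 i) = B i := by
    rw [hmem i hi]
    simp only [B, dif_pos hi, answerElems]
  rw [hB, hq i hih] at hob
  simp only [hB, hq i hih, Function.update_self] at hroot
  have hex : ∃ ob : Option (Fin d × Fin (N n)) × Fin (m / (σ κ + 1 + ℓ) + 1),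
      deviation (B i) (B' i) ob.1 ob.2 ≠ 0 := ⟨(o, b), hob⟩
  refine ⟨i, ?_, ?_⟩
  · simp only [P, dif_pos hex]
    exact hex.choose_spec
  · simp only [P, dif_pos hex]
    exact hroot _ _

/-- By correctness, honest answers lead to `x α`; any other accepted output is therefore undetected
tampering. -/
theorem scheme_integrity (hidx : ∀ n, Function.Injective (idx n)) (hd : t * d < 2 * ℓ)
    (hℓ : 0 < ℓ) {ε : ℕ → ℝ}
    (hε : ∀ κ, (ℓ : ENNReal) * ((t * d : ℕ) / 2 ^ (σ κ + 1)) ≤ ENNReal.ofReal (ε κ)) :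
    (scheme ℓ t d σ N idx).Integrity (ℓ - 1) ε := by
  intro κ n m x α V hV A
  have hV : V.card < ℓ := by omega
  refine le_trans ?_ ((attack_undetected_le (idx := idx) (St := Unit) x α hV
    fun q => (A x q).map fun a => ((), a)).trans (hε κ))
  have e : (scheme ℓ t d σ N idx).clientOutput κ n m x α V A =
      (attack idx α V fun q => (A x q).map fun a => ((), a)).map fun p =>
        (scheme ℓ t d σ N idx).Rec κ n m ((scheme ℓ t d σ N idx).answers x V
          (queryBits idx κ n α p.1) p.2.2) (clientAux κ n α p.1) := by
    rw [attack, PMF.map_bind]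
    simp only [PMF.map_comp]
    change ((scheme ℓ t d σ N idx).Que κ n α).bind _ = _
    rw [que_eq, PMF.bind_map]
    rfl
  rw [e, PMF.toOuterMeasure_map_apply]
  refine MeasureTheory.measure_mono ?_
  rintro p ⟨h1, h2⟩
  refine ⟨Option.isSome_iff_ne_none.2 h2, fun h3 => h1 ?_⟩
  beta_reduce
  rw [h3, answers_honest, rec_ans hidx hd]

end Scheme

/-! ### Perfect simulation of the queries of at most `t` servers -/

section View

variable {ℓ t d σ n N : ℕ}

/-- The coins of the simulator: evaluation points, curves, and points on further curves. -/
abbrev SimRand (ℓ t d σ N : ℕ) : Type :=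
  Params ℓ σ × ((Fin ℓ → Fin (t + 1) → Fin d × Fin N → GF ℓ σ) ×
    (Fin ℓ → Fin ℓ → Fin d × Fin N → GF ℓ σ))

/-- The simulated query to server `i`; the points on the curves of the servers outside `T` are
chosen independently. -/
noncomputable def simQuery (T : Finset (Fin ℓ)) (ρ : SimRand ℓ t d σ N) (i : Fin ℓ) :
    QIdx ℓ t d N → GF ℓ σ
  | (Sum.inl e, k) => ρ.2.1 i e k
  | (Sum.inr j, k) => if j ∈ T then curve (ρ.2.1 j) (node i (ρ.1 i j)) k else ρ.2.2 j i k

theorem curve_add {S K : Type*} [CommRing S] (w w' : Fin (t + 1) → K → S) (z : S) :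
    curve (w + w') z = curve w z + curve w' z := by
  funext k
  simp [curve, mul_add, Finset.sum_add_distrib]

theorem curve_sub {S K : Type*} [CommRing S] (w w' : Fin (t + 1) → K → S) (z : S) :
    curve (w - w') z = curve w z - curve w' z := by
  funext k
  simp [curve, mul_sub, Finset.sum_sub_distrib]

theorem clientCurve_add (idx : Fin n → Fin d → Fin N) (α : Fin n) (a a' : Masks ℓ t d σ N) :
    clientCurve idx α (a + a') =
      clientCurve idx α a + clientCurve idx α a' - clientCurve idx α 0 := by
  funext e
  refine Fin.cases ?_ (fun e => ?_) e <;> simp [clientCurve]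

theorem serverCurve_add (idx : Fin n → Fin d → Fin N) (α : Fin n) (a a' : Masks ℓ t d σ N)
    (i : Fin ℓ) : serverCurve idx α (a + a') i =
      serverCurve idx α a i + serverCurve idx α a' i - serverCurve idx α 0 i := by
  funext e
  refine Fin.cases ?_ (fun e => ?_) e <;>
    simp [serverCurve, clientCurve_add, curve_add, curve_sub]

/-- For fixed test parameters both views are affine in uniform coins, so it is enough to compare
ranges. Neither range depends on `α`: curves of servers in `T` are arbitrary, and so are the points
seen on each other curve. -/
theorem map_query_eq_map_simQuery (idx : Fin n → Fin d → Fin N) (α : Fin n) (r : Params ℓ σ)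
    {T : Finset (Fin ℓ)} (hT : T.card ≤ t) :
    (PMF.uniformOfFintype (Masks ℓ t d σ N)).map
      (fun a (i : T) => query (serverCurve idx α a) r i) =
    (PMF.uniformOfFintype ((Fin ℓ → Fin (t + 1) → Fin d × Fin N → GF ℓ σ) ×
      (Fin ℓ → Fin ℓ → Fin d × Fin N → GF ℓ σ))).map
      (fun b (i : T) => simQuery T (r, b) i) := by
  refine PMF.map_uniformOfFintype_eq ?_ ?_ (Set.Subset.antisymm ?_ ?_)
  · intro a a'
    funext i ⟨s, k⟩
    cases s <;> simp [query, serverCurve_add, curve_add, curve_sub]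
  · intro b b'
    funext i ⟨s, k⟩
    cases s with
    | inl e => simp [simQuery]
    | inr j =>
      by_cases hj : j ∈ T
      · have h0 : curve (0 : Fin (t + 1) → Fin d × Fin N → GF ℓ σ) (node (i : Fin ℓ) (r i j)) k =
          0 := by simp [curve]
        simp [simQuery, hj, curve_add, h0]
      · simp [simQuery, hj]
  · rintro _ ⟨a, rfl⟩
    refine ⟨(serverCurve idx α a, fun j i => curve (serverCurve idx α a j) (node i (r i j))), ?_⟩
    funext i ⟨s, k⟩
    cases s <;> simp [query, simQuery]
  · rintro _ ⟨⟨W, Y⟩, rfl⟩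
    -- A client curve through the index point is made to pass through the prescribed starts of the
    -- curves of the servers in `T`.
    obtain ⟨R, hR⟩ := exists_curve_eq T hT (fun i : Fin ℓ => node (σ := σ) i 0)
      (node_injective 0).injOn (fun i _ => node_ne_zero i 0) (indexPoint _ idx α)
      fun i => W i 0
    -- For `j ∈ T` the higher coefficients are copied from `W j`. For `j ∉ T` the start is already
    -- determined, and the coalition sees at most `t` further points, which are interpolated.
    have hv : ∀ j : Fin ℓ, ∃ v : Fin t → Fin d × Fin N → GF ℓ σ,
        (j ∈ T → (Fin.cons (W j 0) v : Fin (t + 1) → Fin d × Fin N → GF ℓ σ) = W j) ∧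
        (j ∉ T → ∀ i ∈ T, curve (Fin.cons (curve (Fin.cons (indexPoint _ idx α) R :
          Fin (t + 1) → Fin d × Fin N → GF ℓ σ) (node j 0)) v :
            Fin (t + 1) → Fin d × Fin N → GF ℓ σ) (node i (r i j)) = Y j i) := by
      intro j
      by_cases hj : j ∈ T
      · exact ⟨Fin.tail (W j), fun _ => Fin.cons_self_tail (W j), fun h => absurd hj h⟩
      · obtain ⟨v, hv⟩ := exists_curve_eq T hT (fun i : Fin ℓ => node (σ := σ) i (r i j))
          (node_injective fun i => r i j).injOn (fun i _ => node_ne_zero i _)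
          (curve (Fin.cons (indexPoint _ idx α) R :
            Fin (t + 1) → Fin d × Fin N → GF ℓ σ) (node j 0)) (Y j)
        exact ⟨v, fun h => absurd h hj, fun _ => hv⟩
    choose v hv1 hv2 using hv
    have hW : ∀ j ∈ T, serverCurve idx α ((R, v) : Masks ℓ t d σ N) j = W j := by
      intro j hj
      rw [serverCurve, clientCurve, hR j hj]
      exact hv1 j hj
    refine ⟨(R, v), ?_⟩
    funext i ⟨s, k⟩
    cases s with
    | inl e => simp [query, simQuery, hW i i.2]
    | inr j =>
      by_cases hj : j ∈ T
      · simp [query, simQuery, hj, hW j hj]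
      · simp only [query, simQuery, if_neg hj]
        exact congrFun (hv2 j hj i i.2) k

end View

/-! ### Degrees of queries and answers as functions of bits -/

section Degree

variable {ι : Type*} {ℓ t d σ n N D : ℕ}

theorem lowDeg_smul_bit {A : Type*} [AddCommGroup A] [Module (ZMod 2) A] {u : (ι → Bool) → ZMod 2}
    (hu : LowDeg D u) (a : A) : LowDeg D fun v => u v • a :=
  hu.comp_addMonoidHom ((LinearMap.toSpanSingleton (ZMod 2) A a).toAddMonoidHom)

theorem lowDeg_fieldBits_symm {u : (ι → Bool) → Bits (σ + 1 + ℓ)}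
    (hu : ∀ pos, LowDeg D fun v => bitEquiv (u v pos)) :
    LowDeg D fun v => (fieldBits ℓ σ).symm (u v) := by
  simp only [fieldBits_symm]
  refine LowDeg.sum _ fun pos _ => ?_
  have e : (fun v => if u v pos = true then gfBasis ℓ σ pos else 0) =
      fun v => bitEquiv (u v pos) • gfBasis ℓ σ pos := by
    funext v
    cases h : u v pos <;> simp [bitEquiv]
  rw [e]
  exact lowDeg_smul_bit (hu pos) _

theorem lowDeg_node {u : (ι → Bool) → Fin (σ + 1) → ZMod 2} (hu : ∀ b, LowDeg D fun v => u v b)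
    (h : Fin ℓ) : LowDeg D fun v => node (σ := σ) h (u v) := by
  simp only [node, Module.Basis.equivFun_symm_apply]
  refine LowDeg.sum _ fun pos _ => lowDeg_smul_bit ?_ _
  refine Fin.addCases (fun b => ?_) (fun b => ?_) pos
  · simpa using hu b
  · simpa using LowDeg.const _

theorem lowDeg_curve {S K : Type*} [CommRing S] {w : (ι → Bool) → Fin (t + 1) → K → S}
    {z : (ι → Bool) → S} (hw : ∀ e k, LowDeg 1 fun v => w v e k) (hz : LowDeg 1 z) (k : K) :
    LowDeg (t + 1) fun v => curve (w v) (z v) k := by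
  refine LowDeg.sum _ fun e _ => ((hz.pow e).mul (hw e k)).mono ?_
  omega

theorem lowDeg_evalMap {S : Type*} [CommRing S] (idx : Fin n → Fin d → Fin N)
    {X : (ι → Bool) → Fin n → S} {y : (ι → Bool) → Fin d × Fin N → S}
    (hX : ∀ i, LowDeg 1 fun v => X v i) (hy : ∀ k, LowDeg 1 fun v => y v k)
    (o : Option (Fin d × Fin N)) : LowDeg (d + 1) fun v => evalMap idx (X v) (y v) o := by
  have hprod : ∀ (i : Fin n) (s : Finset (Fin d)),
      LowDeg (d + 1) fun v => X v i * ∏ c ∈ s, y v (c, idx i c) := by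
    intro i s
    refine ((hX i).mul (LowDeg.prod s fun c _ => hy (c, idx i c))).mono ?_
    have := s.card_le_univ
    rw [Fintype.card_fin] at this
    omega
  cases o with
  | none => exact LowDeg.sum _ fun i _ => hprod i _
  | some k =>
    refine LowDeg.sum _ fun i _ => ?_
    split_ifs
    · exact hprod i _
    · exact LowDeg.const 0

/-- The degree is counted with values in `S[X]`, where the curve parameter is a constant; taking a
coefficient is additive. -/
theorem lowDeg_curveCoeff {S : Type*} [CommRing S] (idx : Fin n → Fin d → Fin N)
    {X : (ι → Bool) → Fin n → S} {w : (ι → Bool) → Fin (t + 1) → Fin d × Fin N → S}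
    (hX : ∀ i, LowDeg 1 fun v => X v i) (hw : ∀ e k, LowDeg 1 fun v => w v e k) (j : ℕ)
    (o : Option (Fin d × Fin N)) : LowDeg (d + 1) fun v => curveCoeff idx (X v) (w v) j o := by
  have hC : ∀ {g : (ι → Bool) → S}, LowDeg 1 g → LowDeg 1 fun v => (C (g v) : S[X]) :=
    fun hg => hg.comp_addMonoidHom (C : S →+* S[X]).toAddMonoidHom
  refine LowDeg.comp_addMonoidHom (f := fun v => evalMap idx (fun i => C (X v i))
    (curve (fun e k => C (w v e k)) Polynomial.X) o) ?_ (lcoeff S j).toAddMonoidHom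
  refine lowDeg_evalMap idx (fun i => hC (hX i)) (fun k => ?_) o
  refine LowDeg.sum _ fun e _ => ?_
  exact ((LowDeg.const (D := 0) _).mul (hC (hw e k))).mono (by omega)

theorem lowDeg_respond {c : ℕ} (idx : Fin n → Fin d → Fin N)
    {X : (ι → Bool) → Fin n → Fin c → GF ℓ σ} {q : (ι → Bool) → QIdx ℓ t d N → GF ℓ σ}
    (hX : ∀ i b, LowDeg 1 fun v => X v i b) (hq : ∀ k, LowDeg 1 fun v => q v k)
    (a : AIdx ℓ t d N c) : LowDeg (d + 1) fun v => respond idx (X v) (q v) a := by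
  obtain ⟨j | j, o, b⟩ := a
  · exact lowDeg_curveCoeff idx (fun i => hX i b) (fun e k => hq (Sum.inl e, k)) j o
  · exact lowDeg_evalMap idx (fun i => hX i b) (fun k => hq (Sum.inr j, k)) o

theorem lowDeg_simQuery (T : Finset (Fin ℓ)) {ρ : (ι → Bool) → SimRand ℓ t d σ N}
    (h1 : ∀ h i b, LowDeg 1 fun v => (ρ v).1 h i b)
    (h2 : ∀ i e k, LowDeg 1 fun v => (ρ v).2.1 i e k)
    (h3 : ∀ j i k, LowDeg 1 fun v => (ρ v).2.2 j i k) (i : Fin ℓ) (a : QIdx ℓ t d N) :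
    LowDeg (t + 1) fun v => simQuery T (ρ v) i a := by
  obtain ⟨e | j, k⟩ := a
  · exact (h2 i e k).mono (by omega)
  · simp only [simQuery]
    split_ifs
    · exact lowDeg_curve (h2 j) (lowDeg_node (h1 i j) i) k
    · exact (h3 j i k).mono (by omega)

theorem lowDeg_pack {I : Type} [Fintype I] {f : (ι → Bool) → I → GF ℓ σ}
    (hf : ∀ i, LowDeg D fun v => f v i) (b : Fin (Fintype.card I * (σ + 1 + ℓ))) :
    LowDeg D fun v => bitEquiv (pack ℓ σ I (f v) b) := by
  simp only [pack, Equiv.coe_fn_mk, bitEquiv_fieldBits]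
  exact (hf _).comp_addMonoidHom ((gfBasis ℓ σ).coord _).toAddMonoidHom

theorem lowDeg_pack_symm {I : Type} [Fintype I]
    {u : (ι → Bool) → Bits (Fintype.card I * (σ + 1 + ℓ))}
    (hu : ∀ b, LowDeg D fun v => bitEquiv (u v b)) (i : I) :
    LowDeg D fun v => (pack ℓ σ I).symm (u v) i :=
  lowDeg_fieldBits_symm fun _ => hu _

theorem lowDeg_bit (i : ι) (hD : 1 ≤ D) : LowDeg D fun v : ι → Bool => bitEquiv (v i) :=
  LowDeg.input i 1 hD

theorem lowDeg_encBlock {m : ℕ} {u : (ι → Bool) → Bits m}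
    (hu : ∀ j, LowDeg D fun v => bitEquiv (u v j)) (c : Fin (m / (σ + 1 + ℓ) + 1)) :
    LowDeg D fun v => encBlock ℓ σ (u v) c := by
  refine lowDeg_fieldBits_symm fun pos => ?_
  by_cases h : (c : ℕ) * (σ + 1 + ℓ) + pos < m
  · simpa only [dif_pos h] using hu _
  · simpa only [dif_neg h] using LowDeg.const _

end Degree

/-! ### The simulator and the comparison of the two experiments -/

section Simulator

/-- The positions of the random bits of the simulator. -/
abbrev CoinIdx (ℓ t d σ N : ℕ) : Type :=
  (Fin ℓ × Fin ℓ × Fin (σ + 1)) ⊕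
    ((Fin ℓ × Fin (t + 1) × (Fin d × Fin N)) × Fin (σ + 1 + ℓ)) ⊕
      ((Fin ℓ × Fin ℓ × (Fin d × Fin N)) × Fin (σ + 1 + ℓ))

/-- The coins of the simulator as a bit string. -/
noncomputable def coinsEquiv (ℓ t d σ N : ℕ) :
    Bits (Fintype.card (CoinIdx ℓ t d σ N)) ≃ SimRand ℓ t d σ N where
  toFun v :=
    (fun h i b => bitEquiv (v (Fintype.equivFin _ (Sum.inl (h, i, b)))),
      fun i e k => (fieldBits ℓ σ).symm fun pos =>
        v (Fintype.equivFin _ (Sum.inr (Sum.inl ((i, e, k), pos)))),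
      fun j i k => (fieldBits ℓ σ).symm fun pos =>
        v (Fintype.equivFin _ (Sum.inr (Sum.inr ((j, i, k), pos)))))
  invFun ρ b :=
    match (Fintype.equivFin _).symm b with
    | Sum.inl (h, i, b) => bitEquiv.symm (ρ.1 h i b)
    | Sum.inr (Sum.inl ((i, e, k), pos)) => fieldBits ℓ σ (ρ.2.1 i e k) pos
    | Sum.inr (Sum.inr ((j, i, k), pos)) => fieldBits ℓ σ (ρ.2.2 j i k) pos
  left_inv v := by
    funext b
    obtain ⟨b, rfl⟩ := (Fintype.equivFin (CoinIdx ℓ t d σ N)).surjective b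
    rcases b with ⟨h, i, b⟩ | ⟨⟨i, e, k⟩, pos⟩ | ⟨⟨j, i, k⟩, pos⟩ <;> simp
  right_inv ρ := by
    simp

variable {ℓ t d : ℕ} {σ N : ℕ → ℕ} {idx : ∀ n, Fin n → Fin d → Fin (N n)}

/-- The simulated queries as bit strings. -/
noncomputable def simQueryBits (idx : ∀ n, Fin n → Fin d → Fin (N n)) (κ n : ℕ)
    (T : Finset (Fin ℓ)) (ρ : SimRand ℓ t d (σ κ) (N n)) (i : T) :
    Bits ((scheme ℓ t d σ N idx).qlen κ n) :=
  pack ℓ (σ κ) (QIdx ℓ t d (N n)) (simQuery T ρ i)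

theorem lowDeg_ans {ι : Type*} {κ n m : ℕ} {x : (ι → Bool) → Database n m}
    {q : (ι → Bool) → Bits ((scheme ℓ t d σ N idx).qlen κ n)}
    (hx : ∀ i j, LowDeg 1 fun v => bitEquiv (x v i j)) (hq : ∀ b, LowDeg 1 fun v => bitEquiv (q v b))
    (b : Fin ((scheme ℓ t d σ N idx).alen κ n m)) :
    LowDeg (d + 1) fun v => bitEquiv ((scheme ℓ t d σ N idx).Ans κ n m (x v) (q v) b) :=
  lowDeg_pack (fun a => lowDeg_respond (idx n) (fun i => lowDeg_encBlock (hx i))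
    (fun k => lowDeg_pack_symm hq k) a) b

theorem lowDeg_simQueryBits {ι : Type*} {κ n : ℕ} (T : Finset (Fin ℓ))
    {u : (ι → Bool) → Bits (Fintype.card (CoinIdx ℓ t d (σ κ) (N n)))}
    (hu : ∀ b, LowDeg 1 fun v => bitEquiv (u v b)) (i : T)
    (b : Fin ((scheme ℓ t d σ N idx).qlen κ n)) :
    LowDeg (t + 1) fun v => bitEquiv (simQueryBits idx κ n T (coinsEquiv _ _ _ _ _ (u v)) i b) :=
  lowDeg_pack (fun a => lowDeg_simQuery T (fun _ _ _ => hu _)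
    (fun _ _ _ => lowDeg_fieldBits_symm fun _ => hu _)
    (fun _ _ _ => lowDeg_fieldBits_symm fun _ => hu _) i a) b

/-- The number of bits of the state of the simulator: the database and the simulated queries. -/
def stateLen (ℓ n m qlen : ℕ) : ℕ := n * m + ℓ * qlen

/-- A bound for the size of the simulator. -/
def simBound (ℓ t d n m qlen alen coins : ℕ) : ℕ :=
  (stateLen ℓ n m qlen + ℓ * qlen) * ((n * m + coins + 1) ^ (t + 1) * (t + 4) + 1 + 1) +
    (ℓ * alen * ((stateLen ℓ n m qlen + ℓ * alen + 1) ^ (d + 1) * (d + 4) + 3) + 2)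

/-- The state records the database and the simulated queries, so that the second stage can test
whether the given answers are exactly the honest ones. -/
theorem exists_simulator (κ n m : ℕ) (T : Finset (Fin ℓ)) :
    ∃ (S : Simulator n m ((scheme ℓ t d σ N idx).qlen κ n) ((scheme ℓ t d σ N idx).alen κ n m) T)
      (st : Database n m → (T → Bits ((scheme ℓ t d σ N idx).qlen κ n)) → Bits S.stlen),
      (∀ x, S.sim₀ x = (PMF.uniformOfFintype (SimRand ℓ t d (σ κ) (N n))).map fun ρ =>
        (st x (simQueryBits idx κ n T ρ), simQueryBits idx κ n T ρ)) ∧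
      (∀ x q a, S.sim₁ (st x q) a =
        PMF.pure (decide (a = fun j => (scheme ℓ t d σ N idx).Ans κ n m x (q j)))) ∧
      S.size ≤ simBound ℓ t d n m ((scheme ℓ t d σ N idx).qlen κ n)
        ((scheme ℓ t d σ N idx).alen κ n m) (Fintype.card (CoinIdx ℓ t d (σ κ) (N n))) := by
  classical
  set coins := Fintype.card (CoinIdx ℓ t d (σ κ) (N n)) with hcoins
  have hT : Fintype.card T ≤ ℓ := by
    rw [Fintype.card_coe]
    exact T.card_le_univ.trans (by simp)
  let SI : Type := (Fin n × Fin m) ⊕ (T × Fin ((scheme ℓ t d σ N idx).qlen κ n))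
  have hSI : Fintype.card SI ≤ stateLen ℓ n m ((scheme ℓ t d σ N idx).qlen κ n) := by
    simp only [SI, stateLen, Fintype.card_sum, Fintype.card_prod, Fintype.card_fin]
    gcongr
  let eSI : SI ≃ Fin (Fintype.card SI) := Fintype.equivFin SI
  let st : Database n m → (T → Bits ((scheme ℓ t d σ N idx).qlen κ n)) →
      Bits (Fintype.card SI) := fun x q b =>
    Sum.elim (fun ij => x ij.1 ij.2) (fun jb => q jb.1 jb.2) (eSI.symm b)
  -- the first stage
  let I₀ : Type := (Fin n × Fin m) ⊕ Fin coins
  let qry : (I₀ → Bool) → T → Bits ((scheme ℓ t d σ N idx).qlen κ n) := fun v =>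
    simQueryBits idx κ n T (coinsEquiv _ _ _ _ _ fun b => v (Sum.inr b))
  have hqry : ∀ i b, LowDeg (t + 1) fun v => bitEquiv (qry v i b) := fun i b =>
    lowDeg_simQueryBits T (fun b => lowDeg_bit _ le_rfl) i b
  let out₀ : Fin (Fintype.card SI) ⊕ (T × Fin ((scheme ℓ t d σ N idx).qlen κ n)) →
      (I₀ → Bool) → Bool := fun o v =>
    Sum.elim (fun b => st (fun i j => v (Sum.inl (i, j))) (qry v) b) (fun jb => qry v jb.1 jb.2) o
  have hout₀ : ∀ o, LowDeg (t + 1) fun v => bitEquiv (out₀ o v) := by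
    rintro (b | ⟨j, b⟩)
    · simp only [out₀, Sum.elim_inl, st]
      rcases eSI.symm b with ⟨i, j⟩ | ⟨j, b⟩
      · exact lowDeg_bit _ (by omega)
      · exact hqry j b
    · exact hqry j b
  obtain ⟨C₀, hC₀, hs₀⟩ := Circuit.exists_eval_eq fun o => (hout₀ o).cost
  -- the second stage
  let I₁ : Type := (Fin (Fintype.card SI) ⊕ (T × Fin ((scheme ℓ t d σ N idx).alen κ n m))) ⊕ Fin 0
  let db : (I₁ → Bool) → Database n m := fun v i j =>
    v (Sum.inl (Sum.inl (eSI (Sum.inl (i, j)))))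
  let qs : (I₁ → Bool) → T → Bits ((scheme ℓ t d σ N idx).qlen κ n) := fun v j b =>
    v (Sum.inl (Sum.inl (eSI (Sum.inr (j, b)))))
  have hout₁ := Circuit.Cost.forall_mem (ι := I₁)
    (Finset.univ : Finset (T × Fin ((scheme ℓ t d σ N idx).alen κ n m)))
    (f := fun jb v => v (Sum.inl (Sum.inr jb)) ==
      (scheme ℓ t d σ N idx).Ans κ n m (db v) (qs v jb.1) jb.2)
    fun jb _ => (Circuit.Cost.input (Sum.inl (Sum.inr jb))).op
      (LowDeg.cost (lowDeg_ans (idx := idx) (fun _ _ => lowDeg_bit _ le_rfl)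
        (fun _ => lowDeg_bit _ le_rfl) jb.2)) (fun x y => x == y)
  obtain ⟨C₁, hC₁, hs₁⟩ := Circuit.exists_eval_eq (o := Unit) fun _ => hout₁
  refine ⟨⟨coins, 0, Fintype.card SI, C₀, C₁⟩, st, fun x => ?_, fun x q a => ?_, ?_⟩
  · rw [← PMF.map_uniformOfFintype_equiv (coinsEquiv ℓ t d (σ κ) (N n)), PMF.map_comp]
    simp only [Simulator.sim₀, hC₀]
    rfl
  · have h : ∀ r, C₁.eval (Sum.elim (Sum.elim (st x q) fun ji => a ji.1 ji.2) r) () =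
        decide (a = fun j => (scheme ℓ t d σ N idx).Ans κ n m x (q j)) := by
      intro r
      rw [hC₁]
      have hdb : db (Sum.elim (Sum.elim (st x q) fun ji => a ji.1 ji.2) r) = x := by
        funext i j
        simp [db, st]
      have hqs : qs (Sum.elim (Sum.elim (st x q) fun ji => a ji.1 ji.2) r) = q := by
        funext i j
        simp [qs, st]
      simp only [hdb, hqs]
      rw [decide_eq_decide]
      constructor
      · intro h
        funext j b
        simpa using h (j, b) (Finset.mem_univ _)
      · rintro rfl
        simp
    exact (congrArg (fun f => PMF.map f _) (funext h)).trans (PMF.map_const _ _)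
  · have h0 : C₀.size ≤ (stateLen ℓ n m ((scheme ℓ t d σ N idx).qlen κ n) +
        ℓ * (scheme ℓ t d σ N idx).qlen κ n) *
        ((n * m + coins + 1) ^ (t + 1) * (t + 4) + 1 + 1) := by
      refine hs₀.trans ?_
      simp only [Fintype.card_sum, Fintype.card_prod, Fintype.card_fin, I₀]
      gcongr
    have h1 : C₁.size ≤ ℓ * (scheme ℓ t d σ N idx).alen κ n m *
        ((stateLen ℓ n m ((scheme ℓ t d σ N idx).qlen κ n) +
          ℓ * (scheme ℓ t d σ N idx).alen κ n m + 1) ^ (d + 1) * (d + 4) + 3) + 2 := by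
      refine hs₁.trans ?_
      simp only [Finset.card_univ, Fintype.card_sum, Fintype.card_prod, Fintype.card_fin,
        Fintype.card_unit, one_mul, add_zero, zero_add]
      have hpow : (Fintype.card SI + Fintype.card T * (scheme ℓ t d σ N idx).alen κ n m + 1) ^
          (d + 1) * (d + 1 + 3) ≤ (stateLen ℓ n m ((scheme ℓ t d σ N idx).qlen κ n) +
            ℓ * (scheme ℓ t d σ N idx).alen κ n m + 1) ^ (d + 1) * (d + 4) := by gcongr
      exact Nat.add_le_add_right (Nat.add_le_add_right
        (Nat.mul_le_mul (Nat.mul_le_mul_right _ hT) (by omega)) 1) 1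
    exact Nat.add_le_add h0 h1

/-- After the perfect change of view, both experiments run on the same coins and differ only in the
acceptance bit, which disagrees only on `Undetected`. -/
theorem real_ideal_statDist_le {κ n m : ℕ} {T : Finset (Fin ℓ)} (hT : T.card ≤ t) (htℓ : t < ℓ)
    (hidx : ∀ n, Function.Injective (idx n)) (hd : t * d < 2 * ℓ)
    (S : Simulator n m ((scheme ℓ t d σ N idx).qlen κ n) ((scheme ℓ t d σ N idx).alen κ n m) T)
    (st : Database n m → (T → Bits ((scheme ℓ t d σ N idx).qlen κ n)) → Bits S.stlen)
    (h₀ : ∀ x, S.sim₀ x = (PMF.uniformOfFintype (SimRand ℓ t d (σ κ) (N n))).map fun ρ =>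
      (st x (simQueryBits idx κ n T ρ), simQueryBits idx κ n T ρ))
    (h₁ : ∀ x q a, S.sim₁ (st x q) a =
      PMF.pure (decide (a = fun j => (scheme ℓ t d σ N idx).Ans κ n m x (q j))))
    (x : Database n m) (α : Fin n)
    (A : Adversary n m ((scheme ℓ t d σ N idx).qlen κ n) ((scheme ℓ t d σ N idx).alen κ n m) T) :
    statDist ((scheme ℓ t d σ N idx).real κ n m x α T A) ((scheme ℓ t d σ N idx).ideal S x A) ≤
      (ℓ * ((t * d : ℕ) / 2 ^ (σ κ + 1) : ENNReal)).toReal := by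
  classical
  have hreal : (scheme ℓ t d σ N idx).real κ n m x α T A =
      (attack idx α T (A.first x)).bind fun p =>
      A.second p.2.1 ((scheme ℓ t d σ N idx).Rec κ n m
        ((scheme ℓ t d σ N idx).answers x T (queryBits idx κ n α p.1) p.2.2)
        (clientAux κ n α p.1)).isSome := by
    rw [attack, PMF.bind_bind]
    simp only [PMF.bind_map]
    change ((scheme ℓ t d σ N idx).Que κ n α).bind _ = _
    rw [que_eq, PMF.bind_map]
    rfl
  let G : (T → Bits ((scheme ℓ t d σ N idx).qlen κ n)) → PMF A.Out := fun q =>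
    (A.first x q).bind fun p =>
      A.second p.1 (decide (p.2 = fun j => (scheme ℓ t d σ N idx).Ans κ n m x (q j)))
  have hideal : (scheme ℓ t d σ N idx).ideal S x A = ((PMF.uniformOfFintype (SimRand ℓ t d (σ κ) (N n))).map
      (simQueryBits idx κ n T)).bind G := by
    change (S.sim₀ x).bind _ = _
    rw [h₀, PMF.bind_map, PMF.bind_map]
    refine congrArg _ (funext fun ρ => ?_)
    change (A.first x (simQueryBits idx κ n T ρ)).bind (fun p =>
      (S.sim₁ (st x (simQueryBits idx κ n T ρ)) p.2).bind fun b => A.second p.1 b) = _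
    simp only [h₁, PMF.pure_bind]
    rfl
  have hview : (PMF.uniformOfFintype (SimRand ℓ t d (σ κ) (N n))).map (simQueryBits idx κ n T) =
      (PMF.uniformOfFintype (Rand ℓ t d (σ κ) (N n))).map
        fun ω (j : T) => queryBits (σ := σ) idx κ n α ω j := by
    rw [PMF.uniformOfFintype_prod (A := Params ℓ (σ κ)),
      PMF.uniformOfFintype_prod (A := Params ℓ (σ κ)) (B := Masks ℓ t d (σ κ) (N n)),
      PMF.map_bind, PMF.map_bind]
    refine congrArg _ (funext fun r => ?_)
    rw [PMF.map_comp, PMF.map_comp]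
    have := congrArg (PMF.map fun (q : T → QIdx ℓ t d (N n) → GF ℓ (σ κ)) (i : T) =>
      pack ℓ (σ κ) (QIdx ℓ t d (N n)) (q i)) (map_query_eq_map_simQuery (idx n) α r hT)
    rw [PMF.map_comp, PMF.map_comp] at this
    exact this.symm
  have hideal' : (scheme ℓ t d σ N idx).ideal S x A = (attack idx α T (A.first x)).bind fun p =>
      A.second p.2.1
        (decide (p.2.2 = fun j : T => (scheme ℓ t d σ N idx).Ans κ n m x (queryBits idx κ n α p.1 j))) := by
    rw [hideal, hview, PMF.bind_map, attack, PMF.bind_bind]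
    simp only [PMF.bind_map]
    rfl
  rw [hreal, hideal']
  refine (statDist_bind_le _ _ _ (Undetected idx x α T A.St) ?_).trans
    (ENNReal.toReal_mono ?_ (attack_undetected_le x α (hT.trans_lt htℓ) _))
  · intro p hp
    congr 1
    by_cases hh : p.2.2 = fun j : T => (scheme ℓ t d σ N idx).Ans κ n m x (queryBits idx κ n α p.1 j)
    · rw [hh, answers_honest, rec_ans hidx hd]
      simp
    · rw [decide_eq_false hh]
      by_contra hc
      exact hp ⟨(Bool.not_eq_false _).mp hc, hh⟩
  · exact ENNReal.mul_ne_top (ENNReal.natCast_ne_top _)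
      (ENNReal.div_ne_top (ENNReal.natCast_ne_top _) (by positivity))

end Simulator

/-! ### Polynomial bounds and the choice of parameters -/

section PolyBound

variable {J : Type*} {b f g : J → ℕ}

/-- Functions that are bounded by a power of `b`. -/
def PolyBound (b f : J → ℕ) : Prop := ∃ c, ∀ j, f j ≤ b j ^ c

theorem PolyBound.mono (hg : PolyBound b g) (h : ∀ j, f j ≤ g j) : PolyBound b f :=
  let ⟨c, hc⟩ := hg; ⟨c, fun j => (h j).trans (hc j)⟩

theorem PolyBound.const (hb : ∀ j, 2 ≤ b j) (k : ℕ) : PolyBound b fun _ => k :=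
  ⟨k, fun j => Nat.lt_two_pow_self.le.trans (Nat.pow_le_pow_left (hb j) k)⟩

theorem PolyBound.mul (hf : PolyBound b f) (hg : PolyBound b g) :
    PolyBound b fun j => f j * g j := by
  obtain ⟨c, hc⟩ := hf
  obtain ⟨c', hc'⟩ := hg
  exact ⟨c + c', fun j => by rw [pow_add]; exact Nat.mul_le_mul (hc j) (hc' j)⟩

theorem PolyBound.pow (hf : PolyBound b f) (e : ℕ) : PolyBound b fun j => f j ^ e := by
  obtain ⟨c, hc⟩ := hf
  exact ⟨c * e, fun j => by rw [pow_mul]; exact Nat.pow_le_pow_left (hc j) e⟩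

theorem PolyBound.add (hb : ∀ j, 2 ≤ b j) (hf : PolyBound b f) (hg : PolyBound b g) :
    PolyBound b fun j => f j + g j := by
  obtain ⟨c, hc⟩ := hf
  obtain ⟨c', hc'⟩ := hg
  refine ⟨c + c' + 1, fun j => ?_⟩
  have h1 : f j ≤ b j ^ (c + c') :=
    (hc j).trans (Nat.pow_le_pow_right (by have := hb j; omega) (by omega))
  have h2 : g j ≤ b j ^ (c + c') :=
    (hc' j).trans (Nat.pow_le_pow_right (by have := hb j; omega) (by omega))
  rw [pow_succ]
  calc f j + g j ≤ b j ^ (c + c') * 2 := by omega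
    _ ≤ b j ^ (c + c') * b j := Nat.mul_le_mul_left _ (hb j)

theorem PolyBound.simBound (hb : ∀ j, 2 ≤ b j) (ℓ t d : ℕ) {n m qlen alen coins : J → ℕ}
    (hn : PolyBound b n) (hm : PolyBound b m) (hq : PolyBound b qlen) (ha : PolyBound b alen)
    (hc : PolyBound b coins) :
    PolyBound b fun j => simBound ℓ t d (n j) (m j) (qlen j) (alen j) (coins j) := by
  have k := PolyBound.const hb
  have hs : PolyBound b fun j => stateLen ℓ (n j) (m j) (qlen j) :=
    (hn.mul hm).add hb ((k ℓ).mul hq)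
  have h0 := (hs.add hb ((k ℓ).mul hq)).mul
    ((((((hn.mul hm).add hb hc).add hb (k 1)).pow (t + 1)).mul (k (t + 4))).add hb (k 1) |>.add hb
      (k 1))
  have h1 := (((k ℓ).mul ha).mul
    (((((hs.add hb ((k ℓ).mul ha)).add hb (k 1)).pow (d + 1)).mul (k (d + 4))).add hb (k 3))).add hb
      (k 2)
  exact h0.add hb h1

end PolyBound

/-- The side length of the smallest `d`-dimensional cube that contains `n` points. -/
noncomputable def side (d n : ℕ) : ℕ := ⌈(n : ℝ) ^ (1 / (d : ℝ))⌉₊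

theorem le_side_pow {d : ℕ} (hd : 1 ≤ d) (n : ℕ) : n ≤ side d n ^ d := by
  have h : (n : ℝ) ≤ ((side d n ^ d : ℕ) : ℝ) := by
    have hn : (0 : ℝ) ≤ n := n.cast_nonneg
    calc (n : ℝ) = ((n : ℝ) ^ (1 / (d : ℝ))) ^ d := by
          rw [one_div, Real.rpow_inv_natCast_pow hn (by omega)]
      _ ≤ (side d n : ℝ) ^ d := pow_le_pow_left₀ (Real.rpow_nonneg hn _) (Nat.le_ceil _) d
      _ = ((side d n ^ d : ℕ) : ℝ) := by push_cast; rfl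
  exact_mod_cast h

theorem side_le {d n : ℕ} (hd : 1 ≤ d) (hn : 1 ≤ n) : side d n ≤ n := by
  refine Nat.ceil_le.2 ?_
  have h1 : (1 : ℝ) ≤ n := by exact_mod_cast hn
  have h2 : 1 / (d : ℝ) ≤ 1 := by
    rw [div_le_one (by positivity)]
    exact_mod_cast hd
  calc (n : ℝ) ^ (1 / (d : ℝ)) ≤ (n : ℝ) ^ (1 : ℝ) := Real.rpow_le_rpow_of_exponent_le h1 h2
    _ = n := Real.rpow_one _

theorem side_le_two_mul {d n : ℕ} (hn : 1 ≤ n) :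
    (side d n : ℝ) ≤ 2 * (n : ℝ) ^ (1 / (d : ℝ)) := by
  have h1 : (1 : ℝ) ≤ n := by exact_mod_cast hn
  have h2 : (1 : ℝ) ≤ (n : ℝ) ^ (1 / (d : ℝ)) := Real.one_le_rpow h1 (by positivity)
  have h3 := (Nat.ceil_lt_add_one (a := (n : ℝ) ^ (1 / (d : ℝ))) (by positivity)).le
  unfold side
  linarith

theorem exists_index {d : ℕ} (hd : 1 ≤ d) :
    ∃ idx : ∀ n, Fin n → Fin d → Fin (side d n), ∀ n, Function.Injective (idx n) := by
  have h : ∀ n, ∃ f : Fin n → Fin d → Fin (side d n), Function.Injective f := by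
    intro n
    obtain ⟨f⟩ := Function.Embedding.nonempty_of_card_le (α := Fin n)
      (β := Fin d → Fin (side d n)) (by simpa using le_side_pow hd n)
    exact ⟨f, f.injective⟩
  exact ⟨fun n => (h n).choose, fun n => (h n).choose_spec⟩

theorem scheme_statPrivate {ℓ t d : ℕ} {σ N : ℕ → ℕ} {idx : ∀ n, Fin n → Fin d → Fin (N n)}
    (hidx : ∀ n, Function.Injective (idx n)) (htℓ : t < ℓ) (hd : t * d < 2 * ℓ)
    (hN : ∀ n, 1 ≤ n → N n ≤ n) {L : ℕ → ℕ} {a : ℕ} (hσ : ∀ κ, σ κ ≤ L κ + a) {ν : ℕ → ℝ}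
    (hν : Negligible ν)
    (hε : ∀ κ, (ℓ * ((t * d : ℕ) / 2 ^ (σ κ + 1)) : ENNReal).toReal ≤ ν κ) :
    (scheme ℓ t d σ N idx).StatPrivate t L := by
  choose S st h₀ h₁ hS using
    fun κ n m T => exists_simulator (ℓ := ℓ) (t := t) (d := d) (σ := σ) (N := N) (idx := idx) κ n m T
  -- The bound on the alphabet size `N n` is available only for `n ≥ 1`.
  let J := {j : ℕ × ℕ × ℕ // 1 ≤ j.2.1}
  let b : J → ℕ := fun j => j.1.1 + j.1.2.1 + j.1.2.2 + L j.1.1 + 2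
  have hb : ∀ j, 2 ≤ b j := fun j => by simp only [b]; omega
  have k := PolyBound.const hb
  have hbase : ∀ {f : J → ℕ}, (∀ j, f j ≤ b j) → PolyBound b f := fun h =>
    ⟨1, fun j => by rw [pow_one]; exact h j⟩
  have hn : PolyBound b fun j => j.1.2.1 := hbase fun j => by simp only [b]; omega
  have hm : PolyBound b fun j => j.1.2.2 := hbase fun j => by simp only [b]; omega
  have hL : PolyBound b fun j => L j.1.1 := hbase fun j => by simp only [b]; omega
  have hside : PolyBound b fun j => N j.1.2.1 := hn.mono fun j => hN _ j.2
  have hsig : PolyBound b fun j => σ j.1.1 := (hL.add hb (k a)).mono fun j => hσ _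
  have hs : PolyBound b fun j => σ j.1.1 + 1 + ℓ := (hsig.add hb (k 1)).add hb (k ℓ)
  have hK : PolyBound b fun j => d * N j.1.2.1 := (k d).mul hside
  have hq : PolyBound b fun j => (scheme ℓ t d σ N idx).qlen j.1.1 j.1.2.1 := by
    refine (((k (t + 1 + ℓ)).mul hK).mul hs).mono fun j => le_of_eq ?_
    simp [scheme]
  have ha : PolyBound b fun j => (scheme ℓ t d σ N idx).alen j.1.1 j.1.2.1 j.1.2.2 := by
    refine (((k (t * d + 1 + ℓ)).mul ((hK.add hb (k 1)).mul (hm.add hb (k 1)))).mul hs).mono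
      fun j => ?_
    simp only [scheme, Fintype.card_prod, Fintype.card_sum, Fintype.card_fin, Fintype.card_option]
    gcongr
    exact Nat.div_le_self _ _
  have hc : PolyBound b fun j => Fintype.card (CoinIdx ℓ t d (σ j.1.1) (N j.1.2.1)) := by
    refine (((k ℓ).mul ((k ℓ).mul (hsig.add hb (k 1)))).add hb
      ((((k ℓ).mul ((k (t + 1)).mul hK)).mul hs).add hb
        (((k ℓ).mul ((k ℓ).mul hK)).mul hs))).mono fun j => le_of_eq ?_
    simp
  obtain ⟨c, hbound⟩ := PolyBound.simBound hb ℓ t d hn hm hq ha hc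
  refine ⟨S, c, ν, hν, fun κ n m T hn hT => ⟨(hS κ n m T).trans (hbound ⟨(κ, n, m), hn⟩),
    fun x α A => ?_⟩⟩
  exact (real_ideal_statDist_le hT htℓ hidx hd (S κ n m T) (st κ n m T) (h₀ κ n m T) (h₁ κ n m T)
    x α A).trans (hε κ)

/-- The four additional bits give `2^(σ+1) ≥ 32 * p`, while `ℓ * e ≤ 45`, so the error is at most
`45 / (32 * p)`. -/
theorem soundness_error_le {ℓ e p : ℕ} (hℓ : ℓ ≤ 5) (he : e ≤ 9) (hp : 2 < p) :
    (ℓ * ((e : ℕ) / 2 ^ (Nat.clog 2 p + 4 + 1)) : ENNReal) ≤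
      ENNReal.ofReal (3 / ((p : ℝ) - 2)) := by
  have h1 : (p : ℝ) ≤ 2 ^ Nat.clog 2 p := by exact_mod_cast Nat.le_pow_clog (by norm_num) p
  have hp' : (2 : ℝ) < p := by exact_mod_cast hp
  have hreal : (ℓ : ℝ) * (e / 2 ^ (Nat.clog 2 p + 4 + 1)) ≤ 3 / ((p : ℝ) - 2) := by
    have h5 : (ℓ : ℝ) ≤ 5 := by exact_mod_cast hℓ
    have h9 : (e : ℝ) ≤ 9 := by exact_mod_cast he
    rw [← mul_div_assoc, div_le_div_iff₀ (by positivity) (by linarith)]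
    have h45 : (ℓ : ℝ) * e ≤ 45 := by
      calc (ℓ : ℝ) * e ≤ 5 * 9 := by gcongr
        _ = 45 := by norm_num
    have h2 : (2 : ℝ) ^ (Nat.clog 2 p + 4 + 1) = 32 * 2 ^ Nat.clog 2 p := by ring
    rw [h2]
    calc (ℓ : ℝ) * e * ((p : ℝ) - 2) ≤ 45 * ((p : ℝ) - 2) := by
          gcongr
      _ ≤ 3 * (32 * 2 ^ Nat.clog 2 p) := by linarith
  refine le_trans (le_of_eq ?_) (ENNReal.ofReal_le_ofReal hreal)
  rw [ENNReal.ofReal_mul (by positivity), ENNReal.ofReal_div_of_pos (by positivity),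
    ENNReal.ofReal_natCast, ENNReal.ofReal_natCast, ENNReal.ofReal_pow (by norm_num)]
  norm_num

/-- From `log 2 > 1/2` one gets `clog - 1 ≤ 2 * log p`; the remaining `11` is at most `11 * log p`,
since `p ≥ 3 > e`. -/
theorem field_bits_le {p : ℕ} (hp : 2 < p) : (Nat.clog 2 p : ℝ) + 10 ≤ 13 * Real.log p := by
  have hp' : (3 : ℝ) ≤ p := by exact_mod_cast hp
  have hlog : 1 ≤ Real.log p := by
    rw [Real.le_log_iff_exp_le (by linarith)]
    have := Real.exp_one_lt_d9
    linarith
  have hc : 0 < Nat.clog 2 p := Nat.clog_pos (by norm_num) (by omega)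
  have hlt : 2 ^ (Nat.clog 2 p).pred < p := Nat.pow_pred_clog_lt_self (by norm_num) (by omega)
  have h2 : ((Nat.clog 2 p).pred : ℝ) * Real.log 2 ≤ Real.log p := by
    rw [← Real.log_pow]
    exact Real.log_le_log (by positivity) (by exact_mod_cast hlt.le)
  have hpred : ((Nat.clog 2 p).pred : ℝ) = Nat.clog 2 p - 1 := by
    rw [Nat.pred_eq_sub_one, Nat.cast_sub hc, Nat.cast_one]
  have hl2 := Real.log_two_gt_d9
  have h3 : ((Nat.clog 2 p).pred : ℝ) * (1 / 2) ≤ ((Nat.clog 2 p).pred : ℝ) * Real.log 2 := by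
    gcongr
    linarith
  rw [hpred] at h2 h3
  linarith

theorem scheme_comm_le {ℓ t d p : ℕ} {σ : ℕ → ℕ} {idx : ∀ n, Fin n → Fin d → Fin (side d n)}
    (hℓ : ℓ ≤ 5) (ht : 1 ≤ t) (htℓ : t < ℓ) (htd : t * d ≤ 9) (hd : d ≤ 8) (hp : 2 < p)
    {κ n m : ℕ} (hσ : σ κ = Nat.clog 2 p + 4) (hn : 1 ≤ n) (hm : 2 ^ m ≤ p) :
    ((scheme ℓ t d σ (side d) idx).comm κ n m : ℝ) ≤
      30000 * (((ℓ : ℝ) ^ 2 / t) * ((n : ℝ) * ℓ / t) ^ (1 / (d : ℝ)) * Real.log p) := by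
  have hn' : (1 : ℝ) ≤ n := by exact_mod_cast hn
  have hN1 : 1 ≤ side d n := Nat.one_le_ceil_iff.2 (by positivity)
  have hmc : m ≤ Nat.clog 2 p :=
    (Nat.pow_le_pow_iff_right (by norm_num : 1 < 2)).1 (hm.trans (Nat.le_pow_clog (by norm_num) p))
  -- A block has fewer bits than a field element, so a single element carries it.
  have hchunk : m / (σ κ + 1 + ℓ) = 0 := Nat.div_eq_of_lt (by omega)
  have hs : σ κ + 1 + ℓ ≤ Nat.clog 2 p + 10 := by omega
  -- From `ℓ ≤ 5`, `t ≤ 4`, `d ≤ 8` and `t * d ≤ 9`: `1075 = 5 * (10 * 8 + 15 * 9)`. The factors `2`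
  -- (rounding up the side) and `13` (field bits) later raise it to `27950`.
  have hcomm : (scheme ℓ t d σ (side d) idx).comm κ n m ≤
      1075 * (side d n * (Nat.clog 2 p + 10)) := by
    have hq : (t + 1 + ℓ) * (d * side d n) * (σ κ + 1 + ℓ) ≤
        10 * (8 * side d n) * (Nat.clog 2 p + 10) := by gcongr; omega
    have ha : (t * d + 1 + ℓ) * ((d * side d n + 1) * (0 + 1)) * (σ κ + 1 + ℓ) ≤
        15 * ((8 * side d n + side d n) * (0 + 1)) * (Nat.clog 2 p + 10) := by gcongr; omega
    simp only [Scheme.comm, scheme, Fintype.card_prod, Fintype.card_sum, Fintype.card_fin,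
      Fintype.card_option, hchunk]
    calc _ ≤ 5 * (10 * (8 * side d n) * (Nat.clog 2 p + 10) +
          15 * ((8 * side d n + side d n) * (0 + 1)) * (Nat.clog 2 p + 10)) :=
          Nat.mul_le_mul hℓ (Nat.add_le_add hq ha)
      _ = 1075 * (side d n * (Nat.clog 2 p + 10)) := by ring
  have htpos : (0 : ℝ) < t := by exact_mod_cast ht
  have htl : (t : ℝ) ≤ ℓ := by exact_mod_cast htℓ.le
  have hl1 : (1 : ℝ) ≤ ℓ := by
    have : 1 ≤ ℓ := by omega
    exact_mod_cast this
  have hroot : (n : ℝ) ^ (1 / (d : ℝ)) ≤ ((n : ℝ) * ℓ / t) ^ (1 / (d : ℝ)) := by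
    refine Real.rpow_le_rpow (by positivity) ?_ (by positivity)
    rw [le_div_iff₀ htpos]
    gcongr
  have hfac : (1 : ℝ) ≤ (ℓ : ℝ) ^ 2 / t := by
    rw [le_div_iff₀ htpos]
    nlinarith
  have hlog : 0 ≤ Real.log p := Real.log_natCast_nonneg p
  calc ((scheme ℓ t d σ (side d) idx).comm κ n m : ℝ)
      ≤ 1075 * ((side d n : ℝ) * ((Nat.clog 2 p : ℝ) + 10)) := by exact_mod_cast hcomm
    _ ≤ 1075 * ((2 * (n : ℝ) ^ (1 / (d : ℝ))) * (13 * Real.log p)) := by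
        gcongr
        · exact side_le_two_mul hn
        · exact field_bits_le hp
    _ = 27950 * (1 * (n : ℝ) ^ (1 / (d : ℝ)) * Real.log p) := by ring
    _ ≤ 30000 * (((ℓ : ℝ) ^ 2 / t) * ((n : ℝ) * ℓ / t) ^ (1 / (d : ℝ)) * Real.log p) := by
        gcongr
        norm_num

end AuthPIR

/-! ### Assembly -/

open AuthPIR in
theorem theorem2 :
    ∃ C : ℝ, 0 < C ∧
      ∀ (ℓ t : ℕ), 2 ≤ ℓ → ℓ ≤ 5 → 1 ≤ t → t < ℓ →
      ∀ p : ℕ → ℕ, (∀ κ, IsPrimePow (p κ)) → (∀ κ, 2 < p κ) →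
        Negligible (fun κ => 3 / ((p κ : ℝ) - 2)) →
        ∃ Γ : Scheme ℓ,
          Γ.Correct ∧
          Γ.StatPrivate t (fun κ => Nat.clog 2 (p κ)) ∧
          Γ.Integrity (ℓ - 1) (fun κ => 3 / ((p κ : ℝ) - 2)) ∧
          ∀ κ n m : ℕ, 1 ≤ n → 2 ^ m ≤ p κ →
            (Γ.comm κ n m : ℝ) ≤
              C * (((ℓ : ℝ) ^ 2 / t) *
                ((n : ℝ) * ℓ / t) ^ (1 / (((2 * ℓ - 1) / t - 1 : ℕ) : ℝ)) *
                Real.log (p κ)) := by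
  refine ⟨30000, by norm_num, ?_⟩
  intro ℓ t hℓ2 hℓ5 ht htℓ p _ hp hneg
  set d := (2 * ℓ - 1) / t - 1 with hd
  -- `t < ℓ` gives `2 * t ≤ 2 * ℓ - 1`, so the truncated subtraction in `d` is harmless and `d ≥ 1`.
  have h2 : 2 ≤ (2 * ℓ - 1) / t := (Nat.le_div_iff_mul_le ht).2 (by omega)
  have hle : t * ((2 * ℓ - 1) / t) ≤ 2 * ℓ - 1 := Nat.mul_div_le _ _
  have hd1 : 1 ≤ d := by omega
  have htd : t * d ≤ 2 * ℓ - 1 := (Nat.mul_le_mul_left t (by omega)).trans hle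
  have hd8 : d ≤ 8 := by
    have : (2 * ℓ - 1) / t ≤ 2 * ℓ - 1 := Nat.div_le_self _ _
    omega
  obtain ⟨idx, hidx⟩ := exists_index hd1
  have herr := fun κ => soundness_error_le (e := t * d) hℓ5 (by omega) (hp κ)
  have hpos : ∀ κ, 0 ≤ 3 / ((p κ : ℝ) - 2) := fun κ => by
    have : (2 : ℝ) < p κ := by exact_mod_cast hp κ
    exact div_nonneg (by norm_num) (by linarith)
  refine ⟨scheme ℓ t d (fun κ => Nat.clog 2 (p κ) + 4) (side d) idx, ?_, ?_, ?_, ?_⟩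
  · exact scheme_correct hidx (by omega)
  · exact scheme_statPrivate hidx htℓ (by omega) (fun n hn => side_le hd1 hn) (a := 4)
      (fun κ => le_rfl) hneg fun κ => ENNReal.toReal_le_of_le_ofReal (hpos κ) (herr κ)
  · exact scheme_integrity hidx (by omega) (by omega) herr
  · intro κ n m hn hm
    exact scheme_comm_le hℓ5 ht htℓ (by omega) hd8 (hp κ) rfl hn hm
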